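/- For a finite set $A$ of positive integers let $T_n(x)=\frac1{x+n}$ $(n\in A)$, write $[a_1,\dots,a_n]=T_{a_1}\circ\cdots\circ T_{a_n}(0)$ for the finite continued fraction $1/(a_1+1/(a_2+\cdots+1/a_n))$, and let $X_A=\{\lim_{n\to\infty}[a_1,\dots,a_n] : a_k\in A \text{ for all } k\}$ be the limit set. For $0\le t\le 1$ let $(\mathcal L_tf)(x)=\sum_{n\in A}f(T_n(x))\,|T_n'(x)|^t$. Call a function on $[0,1]$ positive Hölder if it takes only positive values and is Hölder continuous with some exponent $\alpha\in(0,1]$. Hensley's conjecture asserts: for every finite $A\subset\{1,2,\dots\}$ with $\dim_H X_A>\frac12$ there is $q_0>0$ such that for every natural number $q\ge q_0$ there exist a natural number $p<q$, some $n\ge1$ and $a_1,\dots,a_n\in A$ with $\frac pq=[a_1,\dots,a_n]$. Now let $A=\{2,4,6,8,10\}$. Then: 1. With $t_0=0.5173570309\,3701730466\,6628474836\,4397337$ one has $t_0<\dim_H X_A<t_0+10^{-37}$, that is, $\dim_H X_A=0.5173570309\,3701730466\,6628474836\,4397337\ldots$ In particular $\dim_H X_A>\frac12$. 2. If $0\le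 t\le1$ and $f$ is a positive Hölder function on $[0,1]$ with $\inf_{[0,1]}\frac{\mathcal L_tf}{f}>1$, then $\dim_H X_A>t$. The function $f(x)=8-2x$ is positive Hölder on $[0,1]$ and satisfies $\inf_{[0,1]}\frac{\mathcal L_{1/2}f}{f}>1$; so it, too, gives $\dim_HX_A>\frac12$. 3. If $p,q$ are coprime natural numbers and $\frac pq=[a_1,\dots,a_n]$ with $n\ge1$ and $a_1,\dots,a_n\in A$, then $q\not\equiv3\pmod 4$. 4. There is no $q_0>0$ such that for every natural number $q\ge q_0$ there exist a natural number $p<q$, some $n\ge1$ and $a_1,\dots,a_n\in A$ with $\frac pq=[a_1,\dots,a_n]$. Hence Hensley's conjecture is false, with $A$ as a counterexample. -/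

import Mathlib

open Set Filter Topology
open scoped NNReal ENNReal

/-- The inverse branch `T_n(x) = 1 / (x + n)` of the Gauss map. -/
noncomputable def cfBranch (n : ℕ) (x : ℝ) : ℝ := 1 / (x + n)

/-- The finite continued fraction `[a₁, …, aₙ] = 1 / (a₁ + 1 / (a₂ + ⋯ + 1 / aₙ))`,
that is, `T_{a₁} ∘ ⋯ ∘ T_{aₙ} (0)`. -/
noncomputable def cfValue (l : List ℕ) : ℝ := l.foldr cfBranch 0

/-- The limit set `X_A` of the iterated function scheme `{T_n : n ∈ A}` : all the limits
`lim_n T_{a 0} ∘ ⋯ ∘ T_{a (n - 1)} (0)` over the sequences `a` with values in `A`. -/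
def cfLimitSet (A : Finset ℕ) : Set ℝ :=
  {x | ∃ a : ℕ → ℕ, (∀ n, a n ∈ A) ∧
    Tendsto (fun n : ℕ => cfValue ((List.range n).map a)) atTop (𝓝 x)}

/-- The transfer operator `L_t f = ∑_{n ∈ A} f(T_n) |T_n'|^t`. -/
noncomputable def cfTransfer (A : Finset ℕ) (t : ℝ) (f : ℝ → ℝ) (x : ℝ) : ℝ :=
  ∑ n ∈ A, f (cfBranch n x) * |deriv (cfBranch n) x| ^ t

/-- Positive Hölder functions on `[0, 1]`, with some exponent `0 < α ≤ 1`
(only the values on `[0, 1]` matter). -/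
def IsPositiveHolder (f : ℝ → ℝ) : Prop :=
  (∃ C α : ℝ≥0, 0 < α ∧ α ≤ 1 ∧ HolderOnWith C α f (Icc 0 1)) ∧ ∀ x ∈ Icc (0 : ℝ) 1, 0 < f x

/-- `p / q = [a₁, …, aₙ]` for some `n ≥ 1` and some digits `a₁, …, aₙ ∈ A`. -/
def HasDigitsIn (A : Finset ℕ) (p q : ℕ) : Prop :=
  ∃ l : List ℕ, l ≠ [] ∧ (∀ a ∈ l, a ∈ A) ∧ (p : ℝ) / (q : ℝ) = cfValue l

/-- Every large `q` is a denominator of a finite continued fraction with digits in `A`.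
The fraction `p / q` need not be in lowest terms here; asking for that as well gives a stronger
property, so the negation of this one is the stronger negation. -/
def HensleyProperty (A : Finset ℕ) : Prop :=
  ∃ q₀ : ℕ, 0 < q₀ ∧ ∀ q : ℕ, q₀ ≤ q → ∃ p : ℕ, p < q ∧ HasDigitsIn A p q

/-- Hensley's conjecture: the property above holds for every finite alphabet of positive integers
whose limit set has Hausdorff dimension larger than `1 / 2`. -/
def HensleyConjecture : Prop :=
  ∀ A : Finset ℕ, (∀ a ∈ A, 1 ≤ a) → (1 / 2 : ℝ≥0∞) < dimH (cfLimitSet A) → HensleyProperty A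

/-- The alphabet `{2, 4, 6, 8, 10}`. -/
def evenAlphabet : Finset ℕ := {2, 4, 6, 8, 10}

/-! ### Words, their Möbius maps and their contraction factors -/

/-! The obstruction is arithmetic. Prepending an even letter `2b` turns `p/q` into `q/(p + 2bq)`,
and from `0/1` this reaches only the residue pairs (0,1), (2,1), (1,0), (1,2) modulo 4, so a reduced
denominator is never 3 modulo 4 (`exists_fraction_mod_four`). Dirichlet supplies arbitrarily large
primes `q ≡ 3`, for which every `p/q` with `0 < p < q` is already reduced. It remains to see that
the dimension exceeds 1/2.

The dimension is read off from `scaleSum A t n`, the sum of `|T_w'(0)|^t` over words `w` of length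
`n`. If it is bounded above in `n`, the cylinders give a cover showing finite `t`-dimensional
Hausdorff measure (`dimH_cfLimitSet_le`). If it is bounded below by a positive constant, that
measure is positive (`le_dimH_cfLimitSet`): the sums are multiplicative up to constants, so the
weights of any finite prefix cover stay away from 0, and compactness of the sequence space reduces
countable covers to finite ones. No conformal measure is constructed. Iterating `L_t f ≤ f` or `L_t
f ≥ f` for one function `f`, bounded between positive constants on an invariant set, yields either
bound.

For the digits, `f` is an explicit polynomial of degree 39 that `L_t` fixes up to a relative error
of `4 / 10^39` on an invariant interval, as exact rational arithmetic on Taylor coefficients shows.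
Moving `t` by `η` changes `L_t f` by a factor of at least `1 + η`, which turns this near-equality
into the two required inequalities. -/

/-- The map `T_{a₁} ∘ ⋯ ∘ T_{aₙ}` of a word. -/
noncomputable def wordMap (l : List ℕ) (x : ℝ) : ℝ := l.foldr cfBranch x

/-- The square root of `|(T_{a₁} ∘ ⋯ ∘ T_{aₙ})'|`. -/
noncomputable def wordScale : List ℕ → ℝ → ℝ
  | [], _ => 1
  | a :: l, x => wordScale l x / (wordMap l x + a)

@[simp] lemma wordMap_nil (x : ℝ) : wordMap [] x = x := rfl

@[simp] lemma wordMap_cons (a : ℕ) (l : List ℕ) (x : ℝ) :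
    wordMap (a :: l) x = 1 / (wordMap l x + a) := rfl

lemma wordMap_append (l m : List ℕ) (x : ℝ) : wordMap (l ++ m) x = wordMap l (wordMap m x) := by
  simp [wordMap, List.foldr_append]

@[simp] lemma wordScale_nil (x : ℝ) : wordScale [] x = 1 := rfl

@[simp] lemma wordScale_cons (a : ℕ) (l : List ℕ) (x : ℝ) :
    wordScale (a :: l) x = wordScale l x / (wordMap l x + a) := rfl

lemma wordScale_append (l m : List ℕ) (x : ℝ) :
    wordScale (l ++ m) x = wordScale l (wordMap m x) * wordScale m x := by
  induction l with
  | nil => simp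
  | cons a l ih => simp only [List.cons_append, wordScale_cons, ih, wordMap_append]; ring

lemma wordMap_mem {l : List ℕ} (hl : ∀ a ∈ l, 2 ≤ a) {x : ℝ} (hx : x ∈ Icc (0 : ℝ) 1) :
    wordMap l x ∈ Icc (0 : ℝ) 1 := by
  induction l with
  | nil => simpa using hx
  | cons a l ih =>
    have h := ih fun b hb => hl b (List.mem_cons_of_mem _ hb)
    have ha : (2 : ℝ) ≤ a := by exact_mod_cast hl a (by simp)
    have h0 := h.1
    rw [wordMap_cons]
    exact ⟨by positivity, by rw [div_le_one (by linarith)]; linarith⟩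

/-- The map and the contraction factor of a word in terms of a matrix. -/
lemma wordMap_eq_moebius {l : List ℕ} (hl : ∀ a ∈ l, 2 ≤ a) :
    ∃ p q r s : ℝ, 0 ≤ p ∧ 0 ≤ q ∧ 0 ≤ r ∧ 0 < s ∧ r ≤ s ∧ p + r ≤ q + s ∧
      2 ^ l.length ≤ s ∧
      ∀ x : ℝ, 0 ≤ x → wordMap l x = (p * x + q) / (r * x + s) ∧
        wordScale l x = 1 / (r * x + s) := by
  induction l with
  | nil => exact ⟨1, 0, 0, 1, by norm_num, by norm_num, by norm_num, by norm_num, by norm_num,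
      by norm_num, by norm_num, fun x _ => by simp⟩
  | cons a l ih =>
    obtain ⟨p, q, r, s, hp, hq, hr, hs, hrs, hsum, hpow, h⟩ :=
      ih fun b hb => hl b (List.mem_cons_of_mem _ hb)
    have ha : (2 : ℝ) ≤ a := by exact_mod_cast hl a (by simp)
    -- The matrix is multiplied on the left by `(0 1; 1 a)`. The inequality `p + r ≤ q + s` is
    -- carried along because it is what makes `r ≤ s` survive.
    refine ⟨r, s, p + a * r, q + a * s, hr, hs.le, by positivity, by positivity, ?_, ?_, ?_,
      fun x hx => ?_⟩
    · nlinarith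
    · nlinarith
    · rw [List.length_cons, pow_succ]; nlinarith
    · obtain ⟨h1, h2⟩ := h x hx
      have hd : 0 < r * x + s := by positivity
      have hd' : 0 < (p + a * r) * x + (q + a * s) := by positivity
      have he : wordMap l x + a = ((p + a * r) * x + (q + a * s)) / (r * x + s) := by
        rw [h1]; field_simp; ring
      constructor
      · rw [wordMap_cons, he, one_div_div]
      · rw [wordScale_cons, he, h2]; field_simp

lemma wordScale_pos {l : List ℕ} (hl : ∀ a ∈ l, 2 ≤ a) {x : ℝ} (hx : 0 ≤ x) :
    0 < wordScale l x := by
  obtain ⟨p, q, r, s, hp, hq, hr, hs, -, -, -, h⟩ := wordMap_eq_moebius hl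
  rw [(h x hx).2]; positivity

lemma wordScale_le_zero {l : List ℕ} (hl : ∀ a ∈ l, 2 ≤ a) {x : ℝ} (hx : 0 ≤ x) :
    wordScale l x ≤ wordScale l 0 := by
  obtain ⟨p, q, r, s, hp, hq, hr, hs, -, -, -, h⟩ := wordMap_eq_moebius hl
  rw [(h x hx).2, (h 0 le_rfl).2]
  apply one_div_le_one_div_of_le <;> nlinarith [mul_nonneg hr hx]

/-- Bounded distortion: `r ≤ s` gives `r x + s ≤ 2 s` on the unit interval. This is the source of
every factor `2 ^ (2 * t)` below. -/
lemma wordScale_zero_le {l : List ℕ} (hl : ∀ a ∈ l, 2 ≤ a) {x : ℝ} (hx : x ∈ Icc (0 : ℝ) 1) :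
    wordScale l 0 ≤ 2 * wordScale l x := by
  obtain ⟨p, q, r, s, hp, hq, hr, hs, hrs, -, -, h⟩ := wordMap_eq_moebius hl
  have h0 := hx.1
  have h1 := hx.2
  rw [(h x hx.1).2, (h 0 le_rfl).2, mul_one_div, div_le_div_iff₀ (by simpa) (by positivity)]
  nlinarith

lemma wordScale_zero_le_pow {l : List ℕ} (hl : ∀ a ∈ l, 2 ≤ a) :
    wordScale l 0 ≤ (1 / 2) ^ l.length := by
  obtain ⟨p, q, r, s, hp, hq, hr, hs, -, -, hpow, h⟩ := wordMap_eq_moebius hl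
  rw [(h 0 le_rfl).2, one_div_pow]
  apply one_div_le_one_div_of_le (by positivity); linarith

/-- An exact identity for Möbius maps of determinant `±1`; it gives upper and lower diameter
estimates without a mean value theorem. -/
lemma abs_wordMap_sub {l : List ℕ} (hl : ∀ a ∈ l, 2 ≤ a) {x y : ℝ} (hx : x ∈ Icc (0 : ℝ) 1)
    (hy : y ∈ Icc (0 : ℝ) 1) :
    |wordMap l x - wordMap l y| = |x - y| * (wordScale l x * wordScale l y) := by
  induction l with
  | nil => simp
  | cons a l ih =>
    have hl' : ∀ b ∈ l, 2 ≤ b := fun b hb => hl b (List.mem_cons_of_mem _ hb)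
    have ha : (2 : ℝ) ≤ a := by exact_mod_cast hl a (by simp)
    have hX : 0 < wordMap l x + a := by linarith [(wordMap_mem hl' hx).1]
    have hY : 0 < wordMap l y + a := by linarith [(wordMap_mem hl' hy).1]
    have he : wordMap (a :: l) x - wordMap (a :: l) y =
        -(wordMap l x - wordMap l y) / ((wordMap l x + a) * (wordMap l y + a)) := by
      simp only [wordMap_cons]; field_simp; ring
    rw [he, abs_div, abs_neg, ih hl', abs_of_pos (mul_pos hX hY), wordScale_cons, wordScale_cons]
    field_simp

/-! ### Sums over the words of a given length -/

/-- The sum of `F` over the words of length `n` with letters in `A`. -/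
def wordSum (A : Finset ℕ) : ℕ → (List ℕ → ℝ) → ℝ
  | 0, F => F []
  | n + 1, F => ∑ a ∈ A, wordSum A n fun l => F (a :: l)

lemma wordSum_le_wordSum {A : Finset ℕ} {n : ℕ} {F G : List ℕ → ℝ}
    (h : ∀ l : List ℕ, l.length = n → (∀ a ∈ l, a ∈ A) → F l ≤ G l) :
    wordSum A n F ≤ wordSum A n G := by
  induction n generalizing F G with
  | zero => exact h [] rfl (by simp)
  | succ n ih =>
    refine Finset.sum_le_sum fun a ha => ih fun l hl hlA => h _ (by simp [hl]) ?_
    simpa [ha] using hlA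

lemma wordSum_congr {A : Finset ℕ} {n : ℕ} {F G : List ℕ → ℝ}
    (h : ∀ l : List ℕ, l.length = n → (∀ a ∈ l, a ∈ A) → F l = G l) :
    wordSum A n F = wordSum A n G :=
  le_antisymm (wordSum_le_wordSum fun l h1 h2 => (h l h1 h2).le)
    (wordSum_le_wordSum fun l h1 h2 => (h l h1 h2).ge)

lemma wordSum_const_mul (A : Finset ℕ) (n : ℕ) (c : ℝ) (F : List ℕ → ℝ) :
    wordSum A n (fun l => c * F l) = c * wordSum A n F := by
  induction n generalizing F with
  | zero => rfl
  | succ n ih => simp only [wordSum, ih, Finset.mul_sum]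

lemma wordSum_finset_sum {ι : Type*} (A : Finset ℕ) (n : ℕ) (I : Finset ι)
    (F : ι → List ℕ → ℝ) :
    wordSum A n (fun l => ∑ i ∈ I, F i l) = ∑ i ∈ I, wordSum A n (F i) := by
  induction n generalizing F with
  | zero => rfl
  | succ n ih => simp only [wordSum, ih]; exact Finset.sum_comm

lemma wordSum_zero (A : Finset ℕ) (n : ℕ) : wordSum A n (fun _ => 0) = 0 := by
  simpa using wordSum_const_mul A n 0 fun _ => 0

lemma wordSum_nonneg {A : Finset ℕ} {n : ℕ} {F : List ℕ → ℝ}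
    (h : ∀ l : List ℕ, l.length = n → (∀ a ∈ l, a ∈ A) → 0 ≤ F l) : 0 ≤ wordSum A n F := by
  rw [← wordSum_zero A n]; exact wordSum_le_wordSum h

lemma wordSum_add (A : Finset ℕ) (n m : ℕ) (F : List ℕ → ℝ) :
    wordSum A (n + m) F = wordSum A n fun w => wordSum A m fun u => F (w ++ u) := by
  induction n generalizing F with
  | zero => simp [wordSum]
  | succ n ih => rw [Nat.succ_add]; simp only [wordSum, ih, List.cons_append]

/-- Summing over the words that extend `w`. -/
lemma wordSum_ite_prefix_le {A : Finset ℕ} {m : ℕ} {F : List ℕ → ℝ} {w : List ℕ}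
    (hF : ∀ u : List ℕ, (∀ a ∈ u, a ∈ A) → 0 ≤ F u) (hw : ∀ a ∈ w, a ∈ A) :
    wordSum A (w.length + m) (fun u => if w <+: u then F u else 0) ≤
      wordSum A m fun u => F (w ++ u) := by
  induction w generalizing F with
  | nil => simp
  | cons a w ih =>
    have ha : a ∈ A := hw a (by simp)
    rw [List.length_cons, Nat.add_right_comm]
    simp only [wordSum]
    rw [Finset.sum_eq_single_of_mem a ha]
    · have := ih (F := fun u => F (a :: u))
        (fun u hu => hF _ (by simpa [ha] using hu)) (fun b hb => hw b (List.mem_cons_of_mem _ hb))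
      simpa [List.cons_prefix_cons] using this
    · intro b _ hba
      have : ∀ l : List ℕ, ¬ (a :: w <+: b :: l) := fun l h =>
        hba (List.cons_prefix_cons.1 h).1.symm
      simp only [this, if_false]
      exact wordSum_zero _ _

lemma wordSum_eq_sum_ofFn (A : Finset ℕ) (n : ℕ) (F : List ℕ → ℝ) :
    wordSum A n F = ∑ v : Fin n → A, F (List.ofFn fun i => (v i : ℕ)) := by
  induction n generalizing F with
  | zero => simp [wordSum]
  | succ n ih =>
    rw [← (Fin.consEquiv fun _ : Fin (n + 1) => A).sum_comp, Fintype.sum_prod_type]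
    simp only [wordSum, ih]
    rw [← Finset.sum_coe_sort A]
    refine Finset.sum_congr rfl fun a _ => Finset.sum_congr rfl fun v _ => ?_
    congr 1
    simp [Fin.consEquiv, List.ofFn_succ]

/-! ### The transfer operator and the growth of sums over words -/

lemma cfTransfer_eq {A : Finset ℕ} (hA : ∀ a ∈ A, 2 ≤ a) (t : ℝ) (f : ℝ → ℝ) {x : ℝ}
    (hx : 0 ≤ x) :
    cfTransfer A t f x = ∑ n ∈ A, f (cfBranch n x) * (x + n) ^ (-(2 * t)) := by
  refine Finset.sum_congr rfl fun n hn => ?_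
  have hn2 : (2 : ℝ) ≤ n := by exact_mod_cast hA n hn
  have hpos : 0 < x + n := by linarith
  have hd : HasDerivAt (cfBranch n) (-1 / (x + n) ^ 2) x := by
    have h : HasDerivAt (fun y : ℝ => y + (n : ℝ)) 1 x := (hasDerivAt_id x).add_const _
    have := h.inv hpos.ne'
    have he : cfBranch n = fun y => (y + (n : ℝ))⁻¹ := by ext y; simp [cfBranch]
    rw [he]; exact this
  rw [hd.deriv, abs_div, abs_neg, abs_one, abs_of_pos (by positivity : 0 < (x + n) ^ 2), one_div,
    Real.inv_rpow (by positivity), ← Real.rpow_natCast, ← Real.rpow_mul hpos.le,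
    ← Real.rpow_neg hpos.le]
  norm_num

/-- The sum of the `t`-th powers of the contraction rates of the words of length `n`. -/
noncomputable def scaleSum (A : Finset ℕ) (t : ℝ) (n : ℕ) : ℝ :=
  wordSum A n fun l => wordScale l 0 ^ (2 * t)

section Transfer

variable {A : Finset ℕ} {t m M : ℝ} {f : ℝ → ℝ} {J : Set ℝ}

/-- `J` is kept general: the unit interval serves for arbitrary test functions, a shorter interval
around `2 / 7` for the numerical one. -/
lemma wordMap_mem_of_invariant (hinv : ∀ a ∈ A, ∀ x ∈ J, cfBranch a x ∈ J) {l : List ℕ}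
    (hl : ∀ a ∈ l, a ∈ A) {x : ℝ} (hx : x ∈ J) : wordMap l x ∈ J := by
  induction l with
  | nil => simpa using hx
  | cons a l ih => exact hinv a (hl a (by simp)) _ (ih fun b hb => hl b (List.mem_cons_of_mem _ hb))

/-- These sums are the iterates `L_t^n f`. The added letter is the outermost map, so it acts on `f`
first: `L_t^(n+1) f = L_t^n (L_t f)`. -/
lemma wordSum_succ_eq (hA : ∀ a ∈ A, 2 ≤ a) (n : ℕ) {x : ℝ} (hx : x ∈ Icc (0 : ℝ) 1) :
    wordSum A (n + 1) (fun l => f (wordMap l x) * wordScale l x ^ (2 * t)) =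
      wordSum A n fun l => cfTransfer A t f (wordMap l x) * wordScale l x ^ (2 * t) := by
  rw [wordSum, ← wordSum_finset_sum]
  refine wordSum_congr fun l _ hl => ?_
  have hl2 : ∀ a ∈ l, 2 ≤ a := fun a ha => hA a (hl a ha)
  have h0 := (wordMap_mem hl2 hx).1
  rw [cfTransfer_eq hA t f h0, Finset.sum_mul]
  refine Finset.sum_congr rfl fun a ha => ?_
  have ha2 : (2 : ℝ) ≤ a := by exact_mod_cast hA a ha
  have hpos : 0 < wordMap l x + a := by linarith
  rw [wordMap_cons, wordScale_cons, Real.div_rpow (wordScale_pos hl2 hx.1).le hpos.le,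
    Real.rpow_neg hpos.le, cfBranch]
  ring

lemma le_wordSum_of_le_cfTransfer (hA : ∀ a ∈ A, 2 ≤ a) (hJ : J ⊆ Icc 0 1)
    (hinv : ∀ a ∈ A, ∀ x ∈ J, cfBranch a x ∈ J) (hf : ∀ x ∈ J, f x ≤ cfTransfer A t f x)
    (n : ℕ) {x : ℝ} (hx : x ∈ J) :
    f x ≤ wordSum A n fun l => f (wordMap l x) * wordScale l x ^ (2 * t) := by
  induction n with
  | zero => simp [wordSum]
  | succ n ih =>
    rw [wordSum_succ_eq hA n (hJ hx)]
    refine ih.trans (wordSum_le_wordSum fun l _ hl => ?_)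
    exact mul_le_mul_of_nonneg_right (hf _ (wordMap_mem_of_invariant hinv hl hx))
      (Real.rpow_nonneg (wordScale_pos (fun a ha => hA a (hl a ha)) (hJ hx).1).le _)

lemma wordSum_le_of_cfTransfer_le (hA : ∀ a ∈ A, 2 ≤ a) (hJ : J ⊆ Icc 0 1)
    (hinv : ∀ a ∈ A, ∀ x ∈ J, cfBranch a x ∈ J) (hf : ∀ x ∈ J, cfTransfer A t f x ≤ f x)
    (n : ℕ) {x : ℝ} (hx : x ∈ J) :
    wordSum A n (fun l => f (wordMap l x) * wordScale l x ^ (2 * t)) ≤ f x := by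
  induction n with
  | zero => simp [wordSum]
  | succ n ih =>
    rw [wordSum_succ_eq hA n (hJ hx)]
    refine (wordSum_le_wordSum fun l _ hl => ?_).trans ih
    exact mul_le_mul_of_nonneg_right (hf _ (wordMap_mem_of_invariant hinv hl hx))
      (Real.rpow_nonneg (wordScale_pos (fun a ha => hA a (hl a ha)) (hJ hx).1).le _)

lemma le_scaleSum (hA : ∀ a ∈ A, 2 ≤ a) (ht : 0 ≤ t) (hJ : J ⊆ Icc 0 1) (hJn : J.Nonempty)
    (hinv : ∀ a ∈ A, ∀ x ∈ J, cfBranch a x ∈ J) (hm : 0 < m) (hmM : ∀ x ∈ J, m ≤ f x ∧ f x ≤ M)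
    (hf : ∀ x ∈ J, f x ≤ cfTransfer A t f x) (n : ℕ) : m / M ≤ scaleSum A t n := by
  obtain ⟨x, hx⟩ := hJn
  have hM : 0 < M := hm.trans_le ((hmM x hx).1.trans (hmM x hx).2)
  rw [div_le_iff₀' hM, scaleSum, ← wordSum_const_mul]
  refine ((hmM x hx).1.trans (le_wordSum_of_le_cfTransfer hA hJ hinv hf n hx)).trans
    (wordSum_le_wordSum fun l _ hl => ?_)
  have hl2 : ∀ a ∈ l, 2 ≤ a := fun a ha => hA a (hl a ha)
  have hp := wordScale_pos hl2 (hJ hx).1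
  exact mul_le_mul (hmM _ (wordMap_mem_of_invariant hinv hl hx)).2
    (Real.rpow_le_rpow hp.le (wordScale_le_zero hl2 (hJ hx).1) (by positivity))
    (Real.rpow_nonneg hp.le _) hM.le

lemma scaleSum_le (hA : ∀ a ∈ A, 2 ≤ a) (ht : 0 ≤ t) (hJ : J ⊆ Icc 0 1) (hJn : J.Nonempty)
    (hinv : ∀ a ∈ A, ∀ x ∈ J, cfBranch a x ∈ J) (hm : 0 < m) (hmM : ∀ x ∈ J, m ≤ f x ∧ f x ≤ M)
    (hf : ∀ x ∈ J, cfTransfer A t f x ≤ f x) (n : ℕ) :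
    scaleSum A t n ≤ 2 ^ (2 * t) * (M / m) := by
  obtain ⟨x, hx⟩ := hJn
  rw [← mul_div_assoc, le_div_iff₀' hm, scaleSum, ← wordSum_const_mul]
  have h1 := (wordSum_le_of_cfTransfer_le hA hJ hinv hf n hx).trans (hmM x hx).2
  refine le_trans ?_ (mul_le_mul_of_nonneg_left h1 (by positivity))
  rw [← wordSum_const_mul]
  refine wordSum_le_wordSum fun l _ hl => ?_
  have hl2 : ∀ a ∈ l, 2 ≤ a := fun a ha => hA a (hl a ha)
  have hp := wordScale_pos hl2 (hJ hx).1
  have hp0 := wordScale_pos hl2 le_rfl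
  calc m * wordScale l 0 ^ (2 * t)
      ≤ f (wordMap l x) * (2 * wordScale l x) ^ (2 * t) :=
        mul_le_mul (hmM _ (wordMap_mem_of_invariant hinv hl hx)).1
          (Real.rpow_le_rpow hp0.le (wordScale_zero_le hl2 (hJ hx)) (by positivity))
          (Real.rpow_nonneg hp0.le _)
          (hm.le.trans (hmM _ (wordMap_mem_of_invariant hinv hl hx)).1)
    _ = _ := by rw [Real.mul_rpow (by norm_num) hp.le]; ring

end Transfer

lemma scaleSum_nonneg {A : Finset ℕ} (hA : ∀ a ∈ A, 2 ≤ a) (t : ℝ) (n : ℕ) :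
    0 ≤ scaleSum A t n :=
  wordSum_nonneg fun _ _ hl =>
    Real.rpow_nonneg (wordScale_pos (fun a ha => hA a (hl a ha)) le_rfl).le _

lemma wordSum_append_le {A : Finset ℕ} (hA : ∀ a ∈ A, 2 ≤ a) {t : ℝ} (ht : 0 ≤ t) (n : ℕ)
    {w : List ℕ} (hw : ∀ a ∈ w, a ∈ A) :
    wordSum A n (fun u => wordScale (w ++ u) 0 ^ (2 * t)) ≤
      wordScale w 0 ^ (2 * t) * scaleSum A t n := by
  rw [scaleSum, ← wordSum_const_mul]
  refine wordSum_le_wordSum fun u _ hu => ?_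
  have hw2 : ∀ a ∈ w, 2 ≤ a := fun a ha => hA a (hw a ha)
  have hu2 : ∀ a ∈ u, 2 ≤ a := fun a ha => hA a (hu a ha)
  have hmem := wordMap_mem hu2 (⟨le_rfl, zero_le_one⟩ : (0 : ℝ) ∈ Icc (0 : ℝ) 1)
  rw [wordScale_append, Real.mul_rpow (wordScale_pos hw2 hmem.1).le (wordScale_pos hu2 le_rfl).le]
  exact mul_le_mul_of_nonneg_right
    (Real.rpow_le_rpow (wordScale_pos hw2 hmem.1).le (wordScale_le_zero hw2 hmem.1) (by positivity))
    (Real.rpow_nonneg (wordScale_pos hu2 le_rfl).le _)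

/-- Together with `wordSum_append_le`, this makes the sums multiplicative up to constants, by the
chain rule and bounded distortion. -/
lemma scaleSum_mul_le {A : Finset ℕ} (hA : ∀ a ∈ A, 2 ≤ a) {t : ℝ} (ht : 0 ≤ t) (n m : ℕ) :
    scaleSum A t n * scaleSum A t m ≤ 2 ^ (2 * t) * scaleSum A t (n + m) := by
  simp only [scaleSum]
  rw [wordSum_add, mul_comm, ← wordSum_const_mul, ← wordSum_const_mul]
  refine wordSum_le_wordSum fun w _ hw => ?_
  rw [mul_comm, ← wordSum_const_mul, ← wordSum_const_mul]
  refine wordSum_le_wordSum fun u _ hu => ?_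
  have hw2 : ∀ a ∈ w, 2 ≤ a := fun a ha => hA a (hw a ha)
  have hu2 : ∀ a ∈ u, 2 ≤ a := fun a ha => hA a (hu a ha)
  have hmem := wordMap_mem hu2 (⟨le_rfl, zero_le_one⟩ : (0 : ℝ) ∈ Icc (0 : ℝ) 1)
  rw [wordScale_append, Real.mul_rpow (wordScale_pos hw2 hmem.1).le (wordScale_pos hu2 le_rfl).le,
    ← mul_assoc, ← Real.mul_rpow (by norm_num) (wordScale_pos hw2 hmem.1).le]
  exact mul_le_mul_of_nonneg_right
    (Real.rpow_le_rpow (wordScale_pos hw2 le_rfl).le (wordScale_zero_le hw2 hmem) (by positivity))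
    (Real.rpow_nonneg (wordScale_pos hu2 le_rfl).le _)

/-- If every word of length `N` extends one of finitely many words, then the contraction rates of
these cannot be too small. -/
lemma le_sum_of_prefix_cover {A : Finset ℕ} (hA : ∀ a ∈ A, 2 ≤ a) {t c : ℝ} (ht : 0 ≤ t)
    (hc : 0 < c) (hZ : ∀ n, c ≤ scaleSum A t n) {ι : Type*} (I : Finset ι) (w : ι → List ℕ)
    (hw : ∀ i ∈ I, ∀ a ∈ w i, a ∈ A) {N : ℕ} (hN : ∀ i ∈ I, (w i).length ≤ N)
    (hcov : ∀ u : List ℕ, u.length = N → (∀ a ∈ u, a ∈ A) → ∃ i ∈ I, w i <+: u) :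
    c / 2 ^ (2 * t) ≤ ∑ i ∈ I, wordScale (w i) 0 ^ (2 * t) := by
  set F : List ℕ → ℝ := fun u => wordScale u 0 ^ (2 * t) with hF
  have hF0 : ∀ u : List ℕ, (∀ a ∈ u, a ∈ A) → 0 ≤ F u := fun u hu =>
    Real.rpow_nonneg (wordScale_pos (fun a ha => hA a (hu a ha)) le_rfl).le _
  have hZN : 0 < scaleSum A t N := hc.trans_le (hZ N)
  have h1 : scaleSum A t N ≤ ∑ i ∈ I, wordSum A N fun u => if w i <+: u then F u else 0 := by
    rw [← wordSum_finset_sum]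
    refine wordSum_le_wordSum fun u hu huA => ?_
    obtain ⟨i, hi, hiu⟩ := hcov u hu huA
    refine le_trans (by simp [hiu, hF]) (Finset.single_le_sum
      (f := fun i => if w i <+: u then F u else 0) (fun j _ => ?_) hi)
    split_ifs
    exacts [hF0 u huA, le_rfl]
  -- The extensions of `w i` carry at most a constant times `F (w i)` of the total sum: their tails
  -- contribute `scaleSum A t m`, which is at most `2 ^ (2 * t) / c` times the full sum. This
  -- replaces the Gibbs property of a conformal measure.
  have h2 : ∀ i ∈ I, wordSum A N (fun u => if w i <+: u then F u else 0) ≤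
      F (w i) * (2 ^ (2 * t) * scaleSum A t N / c) := fun i hi => by
    obtain ⟨m, rfl⟩ := Nat.exists_eq_add_of_le (hN i hi)
    refine (wordSum_ite_prefix_le hF0 (hw i hi)).trans
      ((wordSum_append_le hA ht m (hw i hi)).trans
        (mul_le_mul_of_nonneg_left ?_ (hF0 _ (hw i hi))))
    rw [le_div_iff₀ hc, mul_comm]
    exact (mul_le_mul_of_nonneg_right (hZ _) (scaleSum_nonneg hA t m)).trans
      (scaleSum_mul_le hA ht _ _)
  have h3 := h1.trans (Finset.sum_le_sum h2)
  rw [← Finset.sum_mul] at h3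
  rw [div_le_iff₀ (by positivity)]
  have h4 : scaleSum A t N * c ≤
      ((∑ i ∈ I, F (w i)) * 2 ^ (2 * t)) * scaleSum A t N := by
    calc scaleSum A t N * c
        ≤ ((∑ i ∈ I, F (w i)) * (2 ^ (2 * t) * scaleSum A t N / c)) * c :=
          mul_le_mul_of_nonneg_right h3 hc.le
      _ = _ := by field_simp
  rw [mul_comm] at h4
  exact le_of_mul_le_mul_right h4 hZN

/-! ### The coding of the limit set -/

/-- The word formed by the first `n` terms of a sequence. -/
def seqPrefix (a : ℕ → ℕ) (n : ℕ) : List ℕ := (List.range n).map a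

@[simp] lemma length_seqPrefix (a : ℕ → ℕ) (n : ℕ) : (seqPrefix a n).length = n := by
  simp [seqPrefix]

lemma seqPrefix_add (a : ℕ → ℕ) (n m : ℕ) :
    seqPrefix a (n + m) = seqPrefix a n ++ seqPrefix (fun k => a (n + k)) m := by
  simp [seqPrefix, List.range_add, Function.comp_def]

lemma forall_mem_seqPrefix {P : ℕ → Prop} {a : ℕ → ℕ} (ha : ∀ n, P (a n)) (n : ℕ) :
    ∀ b ∈ seqPrefix a n, P b := by
  simp only [seqPrefix, List.mem_map]
  rintro _ ⟨k, -, rfl⟩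
  exact ha k

/-- The infinite continued fraction of a sequence. -/
noncomputable def cfLimit (a : ℕ → ℕ) : ℝ := limUnder atTop fun n => cfValue (seqPrefix a n)

lemma cfValue_eq_wordMap (l : List ℕ) : cfValue l = wordMap l 0 := rfl

lemma zero_mem_unit : (0 : ℝ) ∈ Icc (0 : ℝ) 1 := ⟨le_rfl, zero_le_one⟩

lemma abs_wordMap_sub_le {l : List ℕ} (hl : ∀ a ∈ l, 2 ≤ a) {x y : ℝ} (hx : x ∈ Icc (0 : ℝ) 1)
    (hy : y ∈ Icc (0 : ℝ) 1) :
    |wordMap l x - wordMap l y| ≤ |x - y| * wordScale l 0 ^ 2 := by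
  rw [abs_wordMap_sub hl hx hy, sq]
  have := wordScale_pos hl hx.1
  have := wordScale_pos hl hy.1
  have := wordScale_pos hl le_rfl
  gcongr
  exacts [wordScale_le_zero hl hx.1, wordScale_le_zero hl hy.1]

lemma tendsto_cfLimit {a : ℕ → ℕ} (ha : ∀ n, 2 ≤ a n) :
    Tendsto (fun n => cfValue (seqPrefix a n)) atTop (𝓝 (cfLimit a)) := by
  refine CauchySeq.tendsto_limUnder (cauchySeq_of_le_geometric (1 / 2) 1 (by norm_num) fun n => ?_)
  have h2 := forall_mem_seqPrefix (P := (2 ≤ ·)) ha n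
  have hy : wordMap [a n] 0 ∈ Icc (0 : ℝ) 1 :=
    wordMap_mem (by simpa using ha n) zero_mem_unit
  have he : seqPrefix a (n + 1) = seqPrefix a n ++ [a n] := by
    rw [seqPrefix_add]; simp [seqPrefix]
  rw [he, cfValue_eq_wordMap, cfValue_eq_wordMap, wordMap_append, Real.dist_eq]
  refine (abs_wordMap_sub_le h2 zero_mem_unit hy).trans ?_
  have hs := wordScale_zero_le_pow h2
  have hs0 := wordScale_pos h2 le_rfl
  rw [length_seqPrefix] at hs
  have h1 : ((1 : ℝ) / 2) ^ n ≤ 1 := pow_le_one₀ (by norm_num) (by norm_num)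
  have h3 : |0 - wordMap [a n] 0| ≤ 1 := by
    rw [zero_sub, abs_neg, abs_of_nonneg hy.1]; exact hy.2
  have h4 : wordScale (seqPrefix a n) 0 ^ 2 ≤ (1 / 2) ^ n := by nlinarith
  exact mul_le_mul h3 h4 (by positivity) zero_le_one

lemma cfLimit_mem {a : ℕ → ℕ} (ha : ∀ n, 2 ≤ a n) : cfLimit a ∈ Icc (0 : ℝ) 1 :=
  isClosed_Icc.mem_of_tendsto (tendsto_cfLimit ha) (Eventually.of_forall fun n =>
    wordMap_mem (forall_mem_seqPrefix (P := (2 ≤ ·)) ha n) zero_mem_unit)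

lemma cfLimit_eq_wordMap {a : ℕ → ℕ} (ha : ∀ n, 2 ≤ a n) (n : ℕ) :
    cfLimit a = wordMap (seqPrefix a n) (cfLimit fun k => a (n + k)) := by
  have hb : ∀ k, 2 ≤ a (n + k) := fun k => ha _
  have h2 := forall_mem_seqPrefix (P := (2 ≤ ·)) ha n
  have h1 : Tendsto (fun m => cfValue (seqPrefix a (n + m))) atTop (𝓝 (cfLimit a)) := by
    simpa only [add_comm] using (tendsto_add_atTop_iff_nat n).2 (tendsto_cfLimit ha)
  refine tendsto_nhds_unique h1 ?_
  have h3 := (tendsto_iff_dist_tendsto_zero.1 (tendsto_cfLimit hb)).mul_const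
    (wordScale (seqPrefix a n) 0 ^ 2)
  rw [zero_mul] at h3
  refine tendsto_iff_dist_tendsto_zero.2 (squeeze_zero (fun _ => dist_nonneg) (fun m => ?_) h3)
  rw [seqPrefix_add, cfValue_eq_wordMap, wordMap_append]
  exact abs_wordMap_sub_le h2 (wordMap_mem (forall_mem_seqPrefix (P := (2 ≤ ·)) hb m) zero_mem_unit)
    (cfLimit_mem hb)

lemma mem_cfLimitSet_iff {A : Finset ℕ} (hA : ∀ a ∈ A, 2 ≤ a) {x : ℝ} :
    x ∈ cfLimitSet A ↔ ∃ a : ℕ → ℕ, (∀ n, a n ∈ A) ∧ cfLimit a = x := by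
  constructor
  · rintro ⟨a, ha, hx⟩
    exact ⟨a, ha, tendsto_nhds_unique (tendsto_cfLimit fun n => hA _ (ha n)) hx⟩
  · rintro ⟨a, ha, rfl⟩
    exact ⟨a, ha, tendsto_cfLimit fun n => hA _ (ha n)⟩

/-! ### Bounds for the Hausdorff dimension -/

lemma ediam_image_wordMap_le {l : List ℕ} (hl : ∀ a ∈ l, 2 ≤ a) :
    Metric.ediam (wordMap l '' Icc 0 1) ≤ ENNReal.ofReal (wordScale l 0 ^ 2) := by
  refine Metric.ediam_le ?_
  rintro _ ⟨x, hx, rfl⟩ _ ⟨y, hy, rfl⟩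
  rw [edist_dist, Real.dist_eq]
  refine ENNReal.ofReal_le_ofReal ((abs_wordMap_sub_le hl hx hy).trans ?_)
  have : |x - y| ≤ 1 := abs_le.2 ⟨by linarith [hx.1, hy.2], by linarith [hx.2, hy.1]⟩
  exact mul_le_of_le_one_left (sq_nonneg _) this

/-- The level-`n` cylinders cover the limit set, have diameters at most `4 ^ (-n)`, and their
diameters to the power `t` sum to at most `scaleSum A t n`. -/
theorem dimH_cfLimitSet_le {A : Finset ℕ} (hA : ∀ a ∈ A, 2 ≤ a) {t C : ℝ} (ht : 0 ≤ t)
    (hZ : ∀ n, scaleSum A t n ≤ C) : dimH (cfLimitSet A) ≤ ENNReal.ofReal t := by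
  have hr : Tendsto (fun n : ℕ => ENNReal.ofReal (((1 / 2 : ℝ) ^ n) ^ 2)) atTop (𝓝 0) := by
    rw [← ENNReal.ofReal_zero]
    refine ENNReal.tendsto_ofReal ?_
    simpa using (tendsto_pow_atTop_nhds_zero_of_lt_one (r := (1 / 2 : ℝ)) (by norm_num)
      (by norm_num)).pow 2
  have hl : ∀ n (v : Fin n → A), ∀ a ∈ List.ofFn (fun i => (v i : ℕ)), a ∈ A := by
    intro n v a ha
    obtain ⟨i, rfl⟩ := (List.mem_ofFn' _ _).1 ha
    exact (v i).2
  have hl2 : ∀ n (v : Fin n → A), ∀ a ∈ List.ofFn (fun i => (v i : ℕ)), 2 ≤ a :=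
    fun n v a ha => hA a (hl n v a ha)
  have key := MeasureTheory.Measure.hausdorffMeasure_le_liminf_sum (ι := fun n : ℕ => Fin n → A)
    t (cfLimitSet A) (l := atTop) _ hr
    (fun n v => wordMap (List.ofFn fun i => (v i : ℕ)) '' Icc 0 1)
    (Eventually.of_forall fun n v => (ediam_image_wordMap_le (hl2 n v)).trans
      (ENNReal.ofReal_le_ofReal (by
        have := wordScale_zero_le_pow (hl2 n v)
        rw [List.length_ofFn] at this
        have h0 := wordScale_pos (hl2 n v) le_rfl
        gcongr)))
    (Eventually.of_forall fun n x hx => by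
      obtain ⟨a, ha, rfl⟩ := (mem_cfLimitSet_iff hA).1 hx
      refine mem_iUnion.2 ⟨fun i => ⟨a i, ha i⟩, ⟨_, cfLimit_mem fun k => hA _ (ha (n + k)), ?_⟩⟩
      rw [cfLimit_eq_wordMap (fun n => hA _ (ha n)) n]
      congr 1
      exact List.ext_getElem (by simp) (by simp [seqPrefix]))
  have hle : ∀ n : ℕ, ∑ v : Fin n → A,
      Metric.ediam (wordMap (List.ofFn fun i => (v i : ℕ)) '' Icc 0 1) ^ t ≤
        ENNReal.ofReal C := fun n => by
    refine le_trans (Finset.sum_le_sum (g := fun v : Fin n → A =>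
      ENNReal.ofReal (wordScale (List.ofFn fun i => (v i : ℕ)) 0 ^ (2 * t))) fun v _ => ?_) ?_
    · have h0 := wordScale_pos (hl2 n v) le_rfl
      rw [Real.rpow_mul h0.le, Real.rpow_two, ← ENNReal.ofReal_rpow_of_nonneg (by positivity) ht]
      exact ENNReal.rpow_le_rpow (ediam_image_wordMap_le (hl2 n v)) ht
    · rw [← ENNReal.ofReal_sum_of_nonneg fun v _ =>
        Real.rpow_nonneg (wordScale_pos (hl2 n v) le_rfl).le _,
        ← wordSum_eq_sum_ofFn A n fun l => wordScale l 0 ^ (2 * t)]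
      exact ENNReal.ofReal_le_ofReal (hZ n)
  have hfin : MeasureTheory.Measure.hausdorffMeasure t (cfLimitSet A) ≠ ∞ := by
    refine ne_top_of_le_ne_top ENNReal.ofReal_ne_top (key.trans (c := ENNReal.ofReal C) ?_)
    exact (liminf_le_liminf (Eventually.of_forall hle)).trans (by simp)
  have := dimH_le_of_hausdorffMeasure_ne_top (d := t.toNNReal) (s := cfLimitSet A)
    (by rwa [Real.coe_toNNReal t ht])
  exact this

/-- A set of limit points is contained in a cylinder of comparable diameter. -/
lemma exists_word_of_set {A : Finset ℕ} {B : ℝ} (hA : ∀ a ∈ A, 2 ≤ a)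
    (hgap : ∀ a ∈ A, ∀ b ∈ A, a < b → a + 2 ≤ b) (hB : ∀ a ∈ A, (a : ℝ) ≤ B) {t : ℝ}
    (ht : 0 < t) (hne : A.Nonempty) (U : Set ℝ) {ε : ℝ≥0} (hε : 0 < ε) :
    ∃ w : List ℕ, (∀ a ∈ w, a ∈ A) ∧
      (∀ a : ℕ → ℕ, (∀ n, a n ∈ A) → cfLimit a ∈ U → seqPrefix a w.length = w) ∧
      ENNReal.ofReal (wordScale w 0 ^ (2 * t)) ≤
        ENNReal.ofReal ((4 * (B + 1) ^ 2) ^ t) * Metric.ediam U ^ t + ε := by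
  classical
  -- If two codes of points of `U` differ, the word is their common prefix up to the first
  -- difference, and the gap between letters bounds the diameter of `U` below. Otherwise `U` meets
  -- the limit set in at most one point, and a long enough prefix has weight below `ε`.
  by_cases h : ∃ n, ∃ a b : ℕ → ℕ, (∀ n, a n ∈ A) ∧ (∀ n, b n ∈ A) ∧ cfLimit a ∈ U ∧
      cfLimit b ∈ U ∧ a n ≠ b n
  · obtain ⟨a, b, ha, hb, haU, hbU, hab⟩ := Nat.find_spec h
    set n := Nat.find h
    have hmin : ∀ c d : ℕ → ℕ, (∀ n, c n ∈ A) → (∀ n, d n ∈ A) → cfLimit c ∈ U → cfLimit d ∈ U →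
        seqPrefix c n = seqPrefix d n := fun c d hc hd hcU hdU =>
      List.map_congr_left fun k hk => by
        by_contra hne
        exact Nat.find_min h (List.mem_range.1 hk) ⟨c, d, hc, hd, hcU, hdU, hne⟩
    refine ⟨seqPrefix a n, forall_mem_seqPrefix ha n, fun c hc hcU => ?_, ?_⟩
    · rw [length_seqPrefix]; exact hmin c a hc ha hcU haU
    · have ha2 : ∀ k, 2 ≤ a k := fun k => hA _ (ha k)
      have hb2 : ∀ k, 2 ≤ b k := fun k => hA _ (hb k)
      have hw2 := forall_mem_seqPrefix (P := (2 ≤ ·)) ha2 n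
      have hsep : ∀ c : ℕ → ℕ, (∀ n, c n ∈ A) → ∃ y ∈ Icc (0 : ℝ) 1,
          (cfLimit fun k => c (n + k)) = 1 / (y + c n) := fun c hc => by
        refine ⟨_, cfLimit_mem (fun k => hA _ (hc (n + (1 + k)))), ?_⟩
        rw [cfLimit_eq_wordMap (fun k => hA _ (hc (n + k))) 1]
        simp [seqPrefix]
      obtain ⟨y, hy, hya⟩ := hsep a ha
      obtain ⟨z, hz, hzb⟩ := hsep b hb
      have hBa := hB _ (ha n)
      have hBb := hB _ (hb n)
      have hya0 : (2 : ℝ) ≤ a n := by exact_mod_cast ha2 n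
      have hzb0 : (2 : ℝ) ≤ b n := by exact_mod_cast hb2 n
      have hy0 := hy.1
      have hy1 := hy.2
      have hz0 := hz.1
      have hz1 := hz.2
      -- Letters differ by at least 2 while `y` and `z` lie in the unit interval, so the two
      -- denominators differ by at least 1.
      have hgap' : 1 ≤ |(z + b n) - (y + a n)| := by
        rcases lt_or_gt_of_ne hab with hlt | hlt
        · have : (a n : ℝ) + 2 ≤ b n := by exact_mod_cast hgap _ (ha n) _ (hb n) hlt
          exact le_abs.2 (Or.inl (by linarith))
        · have : (b n : ℝ) + 2 ≤ a n := by exact_mod_cast hgap _ (hb n) _ (ha n) hlt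
          exact le_abs.2 (Or.inr (by linarith))
      have hdiff : 1 / (B + 1) ^ 2 ≤ |(1 / (y + a n) : ℝ) - 1 / (z + b n)| := by
        have he : (1 / (y + a n) : ℝ) - 1 / (z + b n) =
            ((z + b n) - (y + a n)) / ((y + a n) * (z + b n)) := by
          field_simp
        rw [he, abs_div, abs_of_pos (by positivity : 0 < (y + a n) * (z + b n))]
        refine div_le_div₀ (abs_nonneg _) hgap' (by positivity) ?_
        rw [sq]
        exact mul_le_mul (by linarith) (by linarith) (by positivity) (by linarith)
      have hdist : wordScale (seqPrefix a n) 0 ^ 2 ≤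
          4 * (B + 1) ^ 2 * |cfLimit a - cfLimit b| := by
        have hma : (cfLimit fun k => a (n + k)) ∈ Icc (0 : ℝ) 1 := cfLimit_mem fun k => ha2 _
        have hmb : (cfLimit fun k => b (n + k)) ∈ Icc (0 : ℝ) 1 := cfLimit_mem fun k => hb2 _
        rw [cfLimit_eq_wordMap ha2 n, cfLimit_eq_wordMap hb2 n, ← hmin a b ha hb haU hbU,
          abs_wordMap_sub hw2 hma hmb]
        have h1 := wordScale_zero_le hw2 hma
        have h2 := wordScale_zero_le hw2 hmb
        have h0 := wordScale_pos hw2 le_rfl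
        rw [← hya, ← hzb] at hdiff
        have hB1 : 0 < (B + 1) ^ 2 := by have : 0 < B + 1 := by linarith
                                         positivity
        rw [div_le_iff₀ hB1] at hdiff
        set g := wordScale (seqPrefix a n) 0
        set ga := wordScale (seqPrefix a n) (cfLimit fun k => a (n + k))
        set gb := wordScale (seqPrefix a n) (cfLimit fun k => b (n + k))
        have h3 : g ^ 2 ≤ 4 * (ga * gb) := by nlinarith
        have h4 : 0 ≤ 4 * (ga * gb) := (sq_nonneg g).trans h3
        nlinarith [mul_le_mul_of_nonneg_right hdiff h4]
      have h0 := wordScale_pos hw2 le_rfl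
      have hK : 0 ≤ 4 * (B + 1) ^ 2 := by positivity
      refine le_add_right ?_
      rw [Real.rpow_mul h0.le, Real.rpow_two, ← ENNReal.ofReal_rpow_of_nonneg (by positivity) ht.le,
        ← ENNReal.ofReal_rpow_of_nonneg hK ht.le, ← ENNReal.mul_rpow_of_nonneg _ _ ht.le]
      refine ENNReal.rpow_le_rpow ?_ ht.le
      refine (ENNReal.ofReal_le_ofReal hdist).trans ?_
      rw [ENNReal.ofReal_mul hK]
      refine mul_le_mul_right ?_ _
      rw [← Real.dist_eq, ← edist_dist]
      exact Metric.edist_le_ediam_of_mem haU hbU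
  · push Not at h
    obtain ⟨a, ha, hall⟩ : ∃ a : ℕ → ℕ, (∀ n, a n ∈ A) ∧
        ∀ b : ℕ → ℕ, (∀ n, b n ∈ A) → cfLimit b ∈ U → b = a := by
      by_cases hS : ∃ a : ℕ → ℕ, (∀ n, a n ∈ A) ∧ cfLimit a ∈ U
      · obtain ⟨a, ha, haU⟩ := hS
        exact ⟨a, ha, fun b hb hbU => funext fun n => h n b a hb ha hbU haU⟩
      · obtain ⟨a₀, h₀⟩ := hne
        exact ⟨fun _ => a₀, fun _ => h₀, fun b hb hbU => (hS ⟨b, hb, hbU⟩).elim⟩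
    have ht1 : (1 / 2 : ℝ) ^ (2 * t) < 1 :=
      Real.rpow_lt_one (by norm_num) (by norm_num) (by positivity)
    obtain ⟨n, hn⟩ := exists_pow_lt_of_lt_one (NNReal.coe_pos.2 hε) ht1
    refine ⟨seqPrefix a n, forall_mem_seqPrefix ha n, fun b hb hbU => ?_, ?_⟩
    · rw [length_seqPrefix, hall b hb hbU]
    · have hw2 := forall_mem_seqPrefix (P := (2 ≤ ·)) (fun k => hA _ (ha k)) n
      have hs := wordScale_zero_le_pow hw2
      rw [length_seqPrefix] at hs
      refine le_add_left ?_
      rw [ENNReal.ofReal_le_iff_le_toReal ENNReal.coe_ne_top, ENNReal.coe_toReal]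
      refine (Real.rpow_le_rpow (wordScale_pos hw2 le_rfl).le hs (by positivity)).trans ?_
      rw [← Real.rpow_natCast, ← Real.rpow_mul (by norm_num), mul_comm, Real.rpow_mul (by norm_num),
        Real.rpow_natCast]
      exact hn.le

/-- A cover of the space of sequences by cylinders has a finite subcover. -/
lemma exists_finite_prefix_cover {A : Finset ℕ} (hne : A.Nonempty) (w : ℕ → List ℕ)
    (h : ∀ a : ℕ → ℕ, (∀ n, a n ∈ A) → ∃ i, seqPrefix a (w i).length = w i) :
    ∃ I : Finset ℕ, ∃ N : ℕ, (∀ i ∈ I, (w i).length ≤ N) ∧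
      ∀ u : List ℕ, u.length = N → (∀ a ∈ u, a ∈ A) → ∃ i ∈ I, w i <+: u := by
  have hopen : ∀ i, IsOpen {a : ℕ → A | seqPrefix (fun n => (a n : ℕ)) (w i).length = w i} := by
    intro i
    have hc : Continuous fun (a : ℕ → A) (k : Fin (w i).length) => a k := by fun_prop
    have := (isOpen_discrete {v : Fin (w i).length → A |
      (List.ofFn fun k => (v k : ℕ)) = w i}).preimage hc
    convert this using 1
    ext a
    have he : seqPrefix (fun n => (a n : ℕ)) (w i).length =
        List.ofFn fun k : Fin (w i).length => (a k : ℕ) :=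
      List.ext_getElem (by simp) (by simp [seqPrefix])
    change _ = _ ↔ _ = _
    rw [he]
  obtain ⟨I, hI⟩ := isCompact_univ.elim_finite_subcover _ hopen fun a _ =>
    mem_iUnion.2 (h (fun n => a n) fun n => (a n).2)
  obtain ⟨a₀, h₀⟩ := hne
  refine ⟨I, I.sup fun i => (w i).length, fun i hi => Finset.le_sup (f := fun i => (w i).length) hi,
    fun u hu huA => ?_⟩
  -- The finite word is padded with `a₀` to an infinite sequence; prefixes of length at most `N` do
  -- not see the padding.
  have hmem : ∀ k, u.getD k a₀ ∈ A := fun k => by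
    rcases lt_or_ge k u.length with hk | hk
    · rw [List.getD_eq_getElem _ _ hk]; exact huA _ (List.getElem_mem hk)
    · rw [List.getD_eq_default _ _ hk]; exact h₀
  obtain ⟨i, hi, hiu⟩ : ∃ i ∈ I, seqPrefix (fun k => u.getD k a₀) (w i).length = w i := by
    simpa using hI (mem_univ fun k => ⟨u.getD k a₀, hmem k⟩)
  refine ⟨i, hi, ?_⟩
  have hlen : (w i).length ≤ u.length :=
    hu ▸ Finset.le_sup (f := fun i => (w i).length) hi
  have : w i = u.take (w i).length := by
    conv_lhs => rw [← hiu]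
    refine List.ext_getElem (by simpa using hlen) fun k h1 h2 => ?_
    have hk : k < u.length := (by simpa using h1 : k < (w i).length).trans_le hlen
    simp [seqPrefix, hk]
  rw [this]
  exact List.take_prefix _ _

theorem le_dimH_cfLimitSet {A : Finset ℕ} (hA : ∀ a ∈ A, 2 ≤ a)
    (hgap : ∀ a ∈ A, ∀ b ∈ A, a < b → a + 2 ≤ b) {t c : ℝ} (ht : 0 < t) (hc : 0 < c)
    (hZ : ∀ n, c ≤ scaleSum A t n) : ENNReal.ofReal t ≤ dimH (cfLimitSet A) := by
  have hne : A.Nonempty := by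
    by_contra hcon
    rw [Finset.not_nonempty_iff_eq_empty] at hcon
    have := hZ 1
    rw [hcon] at this
    simp [scaleSum, wordSum] at this
    linarith
  set B : ℝ := ((A.sup id : ℕ) : ℝ)
  have hB : ∀ a ∈ A, (a : ℝ) ≤ B := fun a ha => by
    have : a ≤ A.sup id := Finset.le_sup (f := id) ha
    exact Nat.cast_le.2 this
  have hB0 : 0 ≤ B := Nat.cast_nonneg _
  set K : ℝ := (4 * (B + 1) ^ 2) ^ t
  have hK : 0 < K := Real.rpow_pos_of_pos (by positivity) _
  set c' := c / 2 ^ (2 * t)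
  have hc' : 0 < c' := by positivity
  have key : ENNReal.ofReal (c' / (2 * K)) ≤
      MeasureTheory.Measure.hausdorffMeasure t (cfLimitSet A) := by
    rw [MeasureTheory.Measure.hausdorffMeasure_apply]
    -- The estimate holds for covers of any mesh, so mesh 1 suffices.
    refine le_iSup₂_of_le 1 one_pos (le_iInf fun U => le_iInf fun hU => le_iInf fun _ => ?_)
    -- The errors from sets containing at most one limit point total less than half of `c'`, leaving
    -- the other half for the diameters.
    obtain ⟨ε, hε, hεsum⟩ := ENNReal.exists_pos_sum_of_countable
      (ENNReal.ofReal_pos.2 (half_pos hc')).ne' ℕ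
    choose w hwA hwU hw using fun i => exists_word_of_set hA hgap hB ht hne (U i) (hε i)
    obtain ⟨I, N, hN, hcov⟩ := exists_finite_prefix_cover hne w fun a ha => by
      obtain ⟨i, hi⟩ := mem_iUnion.1 (hU ((mem_cfLimitSet_iff hA).2 ⟨a, ha, rfl⟩))
      exact ⟨i, hwU i a ha hi⟩
    have h1 := le_sum_of_prefix_cover hA ht.le hc hZ I w (fun i _ => hwA i) hN hcov
    set S := ∑' n, ⨆ _ : (U n).Nonempty, Metric.ediam (U n) ^ t
    have h2 : ENNReal.ofReal c' ≤ ENNReal.ofReal K * S + ENNReal.ofReal (c' / 2) := by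
      calc ENNReal.ofReal c' ≤ ENNReal.ofReal (∑ i ∈ I, wordScale (w i) 0 ^ (2 * t)) :=
            ENNReal.ofReal_le_ofReal h1
        _ = ∑ i ∈ I, ENNReal.ofReal (wordScale (w i) 0 ^ (2 * t)) :=
            ENNReal.ofReal_sum_of_nonneg fun i _ =>
              Real.rpow_nonneg (wordScale_pos (fun a ha => hA a (hwA i a ha)) le_rfl).le _
        _ ≤ ∑ i ∈ I, (ENNReal.ofReal K * (⨆ _ : (U i).Nonempty, Metric.ediam (U i) ^ t) + ε i) := by
            refine Finset.sum_le_sum fun i _ => (hw i).trans ?_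
            gcongr
            rcases (U i).eq_empty_or_nonempty with he | he
            · simp [he, ENNReal.zero_rpow_of_pos ht]
            · simp [he]
        _ = ENNReal.ofReal K * ∑ i ∈ I, (⨆ _ : (U i).Nonempty, Metric.ediam (U i) ^ t) +
              ∑ i ∈ I, (ε i : ℝ≥0∞) := by rw [Finset.sum_add_distrib, Finset.mul_sum]
        _ ≤ _ := by
            gcongr
            · exact ENNReal.sum_le_tsum I
            · exact (ENNReal.sum_le_tsum I).trans hεsum.le
    by_cases hS : S = ∞
    · rw [hS]; exact le_top
    · rw [← ENNReal.ofReal_toReal hS] at h2 ⊢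
      rw [← ENNReal.ofReal_mul hK.le, ← ENNReal.ofReal_add (by positivity) (by positivity),
        ENNReal.ofReal_le_ofReal_iff (by positivity)] at h2
      refine ENNReal.ofReal_le_ofReal ?_
      rw [div_le_iff₀ (by positivity)]
      linarith
  refine le_dimH_of_hausdorffMeasure_ne_zero (d := t.toNNReal) ?_
  rw [Real.coe_toNNReal t ht.le]
  exact ((ENNReal.ofReal_pos.2 (by positivity)).trans_le key).ne'

/-! ### Rational data approximating the eigenfunction and its exact verification -/

/-- The sum of the first `n` terms of `f`. -/
def partialSum (f : ℕ → ℚ) (n : ℕ) : ℚ := Nat.rec 0 (fun i s => s + f i) n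

lemma partialSum_eq (f : ℕ → ℚ) (n : ℕ) : partialSum f n = ∑ i ∈ Finset.range n, f i := by
  induction n with
  | zero => rfl
  | succ n ih => rw [Finset.sum_range_succ, ← ih]; rfl

/-- The coefficients `a (a + 1) ⋯ (a + n - 1) / n!` of the series of `(1 - v) ^ (-a)`. -/
def risingCoeff {K : Type*} [Field K] (a : K) (n : ℕ) : K :=
  Nat.rec 1 (fun i s => s * (a + i) / (i + 1)) n

lemma risingCoeff_zero {K : Type*} [Field K] (a : K) : risingCoeff a 0 = 1 := rfl

lemma risingCoeff_succ {K : Type*} [Field K] (a : K) (n : ℕ) :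
    risingCoeff a (n + 1) = risingCoeff a n * (a + n) / (n + 1) := rfl

lemma cast_risingCoeff (a : ℚ) (n : ℕ) :
    ((risingCoeff a n : ℚ) : ℝ) = risingCoeff (a : ℝ) n := by
  induction n with
  | zero => simp [risingCoeff_zero]
  | succ n ih => rw [risingCoeff_succ, risingCoeff_succ, ← ih]; push_cast; rfl

/-- A rational approximation of `2 dim X_A` for `A = {2, 4, 6, 8, 10}`. -/
def twiceDim : ℚ := 1034714061874034609333256949672879467580983 / 10 ^ 42

/-- The coefficients of a polynomial approximating the positive eigenfunction of `L_t` for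
`t = twiceDim / 2`. -/
def eigCoeff (k : ℕ) : ℚ :=
  ([1000000000000000000000000000000000000000000,
    -296011209727978970671528353281055894427893,
    107006331077031165081905985331291660386624,
    -43325713625956205533277661221091992249180,
    18542990774635033117573409334781489897806,
    -8154111130458700855452356375273994652338,
    3636710982556621685638948505054972755120,
    -1635241017516892147063208762815826035191,
    739185026733442431056657926736586390256,
    -335427472391988602584127202369400577446,
    152681023622682687421233634865663851489,
    -69681897528403371972165284587903802908,
    31877191883642607075660576763608279056,
    -14614256751560425996743076263546589701,
    6713350290705451008132823767445888300,
    -3089632791840002161145462305852485700,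
    1424375138005375684951456272970721169,
    -657719850652406569549057496562233914,
    304164803474501705364738226466948824,
    -140858736175939288250125249045205140,
    65316612698228442674508769401047342,
    -30324213098041460240261570388966683,
    14094352033473222585368606632998811,
    -6557776104899816083125462808117702,
    3054162810984436548215694609643190,
    -1423705202716764535856210138061045,
    664201428097878189572455568933581,
    -310064068900181085360977079077841,
    144763456731757748416388977413380,
    -67501924925834936035528671822843,
    31324289008041737214829128255441,
    -14353510459861008750496450102904,
    6399673103945644816375843608073,
    -2711220809832290339808306997189,
    1055209604314841693311312476586,
    -361026933820118374999544553712,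
    102584004522881641326915703899,
    -22374446407634268417713981538,
    3291297052074369642772009519,
    -242713292903632729620581924] : List ℤ).getD k 0 / 10 ^ 42

/-- The points `2 / 7 + n` for `n = 2 i + 2`. -/
def centre (i : ℕ) : ℚ := (16 + 14 * i) / 7

/-- Lower approximations of `centre i ^ (-twiceDim)`. -/
def centreWeight (i : ℕ) : ℚ :=
  ([42512333833027307897149956669396994759021338,
    22183838368642894574953589829878262787764836,
    14925580505241646781020387416061196692870184,
    11214788396662242137609293475160121208078239,
    8966578893590383687186612203295579514691463] : List ℤ).getD i 0 / 10 ^ 44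

/-- Lower approximations of `log (centre i) / 4`. -/
def quarterLog (i : ℕ) : ℚ :=
  ([2066696432961169831408939355973816356662289519,
    3638218081517105175769709870409275456528768292,
    4595698712157369644477637693595756765839055982,
    5286332153727765078737878525942271109832320796,
    5826889924901855014842085236941003459710991972] : List ℤ).getD i 0 / 10 ^ 46

/-- The weighted sum of powers of `1 / centre i`. -/
def weightedPow (k : ℕ) : ℚ := partialSum (fun i => centreWeight i * (1 / centre i) ^ k) 5

/-- The Taylor coefficients at `2 / 7` of the approximate image under `L_t` of the polynomial
with coefficients `eigCoeff`. -/
def imageCoeff (j : ℕ) : ℚ :=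
  (-1) ^ j * partialSum
    (fun k => eigCoeff k * risingCoeff (k + twiceDim) j * weightedPow (k + j)) 40

/-- The Taylor coefficients at `2 / 7` of the polynomial with coefficients `eigCoeff`. -/
def eigTaylorCoeff (j : ℕ) : ℚ :=
  partialSum (fun k => eigCoeff k * k.choose j * (2 / 7) ^ (k - j)) 40

/-- The Taylor polynomial of `exp`. -/
def expTaylor (y : ℚ) : ℚ := partialSum (fun m => y ^ m / m.factorial) 36

/-- A bound for the remainder of the Taylor polynomial of `exp` on `[0, 1]`. -/
def expRemainder (y : ℚ) : ℚ := y ^ 36 * (36 + 1) / (Nat.factorial 36 * 36)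

/-- The factor `5 ^ j` is cancelled by `|u| ^ j ≤ 5 ^ (-j)` on the interval of radius `1 / 5` around
`2 / 7`. -/
lemma imageCoeff_sub_le :
    ∀ j < 44, |imageCoeff j - eigTaylorCoeff j| ≤ 5 ^ j * (1 / 10 ^ 41) := by
  decide +kernel

lemma truncation_le :
    partialSum (fun k => |eigCoeff k| * risingCoeff (k + twiceDim) 44 * weightedPow (k + 44)) 40 ≤
      5 ^ 44 * (1 / 10 ^ 40) := by
  decide +kernel

/-- Quarters of logarithms keep the exponents in `[0, 1]`, where the remainder bound for the
exponential applies; fourth powers undo the division. -/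
lemma centreWeight_check : ∀ i < 5,
    (0 ≤ centreWeight i ∧ 0 ≤ quarterLog i ∧ quarterLog i + 1 / 10 ^ 46 ≤ 1 ∧
      twiceDim * (quarterLog i + 1 / 10 ^ 46) ≤ 1) ∧
    (expTaylor (quarterLog i) + expRemainder (quarterLog i)) ^ 4 ≤ centre i ∧
    centre i ≤ expTaylor (quarterLog i + 1 / 10 ^ 46) ^ 4 ∧
    centreWeight i * (expTaylor (twiceDim * (quarterLog i + 1 / 10 ^ 46)) +
      expRemainder (twiceDim * (quarterLog i + 1 / 10 ^ 46))) ^ 4 ≤ 1 ∧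
    1 ≤ centreWeight i * (1 + 1 / 10 ^ 42) * expTaylor (twiceDim * quarterLog i) ^ 4 := by
  decide +kernel

/-- As the constant coefficient is 1, the other terms add up to at most 1/2 on `[0, 1/2]`, which
keeps `eigPoly` between 1/2 and 3/2 there. -/
lemma sum_abs_eigCoeff_le : partialSum (fun k => |eigCoeff k| * (1 / 2) ^ k) 40 ≤ 3 / 2 := by
  decide +kernel

lemma eigCoeff_zero : eigCoeff 0 = 1 := by
  decide +kernel

/-! ### The binomial series with remainder -/

lemma risingCoeff_nonneg {σ : ℝ} (hσ : 0 ≤ σ) (n : ℕ) : 0 ≤ risingCoeff σ n := by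
  induction n with
  | zero => simp [risingCoeff_zero]
  | succ n ih => rw [risingCoeff_succ]; positivity

lemma choose_neg_eq_risingCoeff (σ : ℝ) (n : ℕ) :
    Ring.choose (-σ) n = (-1) ^ n * risingCoeff σ n := by
  rw [Ring.choose_eq_smul, smul_eq_mul]
  induction n with
  | zero => simp [risingCoeff_zero]
  | succ n ih =>
    rw [risingCoeff_succ, descPochhammer_succ_right, Polynomial.smeval_mul, Nat.factorial_succ]
    have h : (Polynomial.X - (n : Polynomial ℤ)).smeval (-σ) = -σ - n := by
      simp [Polynomial.smeval_sub, Polynomial.smeval_natCast]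
    have hf : (n.factorial : ℝ) ≠ 0 := by positivity
    rw [h]
    push_cast
    have h1 : (descPochhammer ℤ n).smeval (-σ) = (-1) ^ n * risingCoeff σ n * n.factorial := by
      rw [← ih]; field_simp
    rw [h1, pow_succ]
    field_simp
    ring

lemma hasSum_one_add_rpow_neg (σ : ℝ) {v : ℝ} (hv : |v| < 1) :
    HasSum (fun j : ℕ => (-1) ^ j * risingCoeff σ j * v ^ j) ((1 + v) ^ (-σ)) := by
  have h := (Real.one_add_rpow_hasFPowerSeriesOnBall_zero (a := -σ)).hasSum (y := v) (by
    simpa [Metric.mem_eball, edist_dist, Real.dist_eq] using hv)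
  rw [zero_add] at h
  refine h.congr_fun fun j => ?_
  rw [binomialSeries_apply, choose_neg_eq_risingCoeff, List.ofFn_const, List.prod_replicate,
    smul_eq_mul]

/-- From index `J` on, consecutive coefficients have ratio `(σ + n) / (n + 1) ≤ 2`, because `σ ≤ J +
2`. With `|v| ≤ 1 / 4` the tail is dominated by a geometric series of ratio 1/2, hence by twice its
first term. -/
lemma abs_one_add_rpow_sub_le {σ v : ℝ} {J : ℕ} (hσ : 0 ≤ σ) (hJ : σ ≤ J + 2) (hv : |v| ≤ 1 / 4) :
    |(1 + v) ^ (-σ) - ∑ j ∈ Finset.range J, (-1) ^ j * risingCoeff σ j * v ^ j| ≤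
      2 * risingCoeff σ J * |v| ^ J := by
  have h := hasSum_one_add_rpow_neg σ (hv.trans_lt (by norm_num) : |v| < 1)
  have ht := (hasSum_nat_add_iff' J).2 h
  have hr : ∀ i, risingCoeff σ (i + J) ≤ risingCoeff σ J * 2 ^ i := fun i => by
    induction i with
    | zero => simp
    | succ i ih =>
      rw [Nat.add_right_comm, risingCoeff_succ, pow_succ, ← mul_assoc, mul_div_assoc]
      refine mul_le_mul ih ?_ (by positivity)
        (mul_nonneg (risingCoeff_nonneg hσ _) (by positivity))
      rw [div_le_iff₀ (by positivity)]
      push_cast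
      have : (0 : ℝ) ≤ i := Nat.cast_nonneg _
      have : (0 : ℝ) ≤ J := Nat.cast_nonneg _
      linarith
  have hg : HasSum (fun i : ℕ => risingCoeff σ J * |v| ^ J * (1 / 2) ^ i)
      (risingCoeff σ J * |v| ^ J * 2) := hasSum_geometric_two.mul_left _
  have hle : ∀ i : ℕ, ‖(-1) ^ (i + J) * risingCoeff σ (i + J) * v ^ (i + J)‖ ≤
      risingCoeff σ J * |v| ^ J * (1 / 2) ^ i := fun i => by
    rw [norm_mul, norm_mul, norm_pow, norm_pow, norm_neg, norm_one, one_pow, one_mul,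
      Real.norm_eq_abs, Real.norm_eq_abs, abs_of_nonneg (risingCoeff_nonneg hσ _), pow_add]
    calc risingCoeff σ (i + J) * (|v| ^ i * |v| ^ J)
        ≤ (risingCoeff σ J * 2 ^ i) * ((1 / 4) ^ i * |v| ^ J) := by
          have h2 : |v| ^ i ≤ (1 / 4) ^ i := by gcongr
          exact mul_le_mul (hr i) (mul_le_mul_of_nonneg_right h2 (by positivity)) (by positivity)
            (mul_nonneg (risingCoeff_nonneg hσ _) (by positivity))
      _ = risingCoeff σ J * |v| ^ J * (1 / 2) ^ i := by
          have : (2 : ℝ) ^ i * (1 / 4) ^ i = (1 / 2) ^ i := by rw [← mul_pow]; norm_num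
          rw [← this]; ring
  have := ht.norm_le_of_bounded hg hle
  rw [Real.norm_eq_abs] at this
  linarith

/-! ### The approximate eigenfunction -/

/-- The polynomial with coefficients `eigCoeff`. -/
noncomputable def eigPoly (x : ℝ) : ℝ := ∑ k ∈ Finset.range 40, (eigCoeff k : ℝ) * x ^ k

/-- `f (T_n x)` times a power of `1 + (x - 2 / 7) / (2 / 7 + n)`, where `f = eigPoly` and
`n = 2 i + 2`. -/
noncomputable def branchTerm (u : ℝ) (i : ℕ) : ℝ :=
  ∑ k ∈ Finset.range 40, (eigCoeff k : ℝ) * (1 / (centre i : ℝ)) ^ k *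
    (1 + u / centre i) ^ (-(k + twiceDim : ℝ))

lemma centre_ge (i : ℕ) : (16 / 7 : ℝ) ≤ centre i := by
  have : (0 : ℝ) ≤ i := Nat.cast_nonneg _
  rw [centre]; push_cast; linarith

lemma centreWeight_nonneg {i : ℕ} (hi : i < 5) : (0 : ℝ) ≤ centreWeight i := by
  exact_mod_cast (centreWeight_check i hi).1.1

lemma cast_twiceDim_mem : (1 : ℝ) ≤ twiceDim ∧ (twiceDim : ℝ) ≤ 2 := by
  constructor <;> · rw [twiceDim]; push_cast; norm_num

lemma cast_weightedPow (k : ℕ) : ((weightedPow k : ℚ) : ℝ) =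
    ∑ i ∈ Finset.range 5, (centreWeight i : ℝ) * (1 / (centre i : ℝ)) ^ k := by
  rw [weightedPow, partialSum_eq]; push_cast; rfl

lemma cast_imageCoeff (j : ℕ) : ((imageCoeff j : ℚ) : ℝ) = (-1) ^ j *
    ∑ k ∈ Finset.range 40, (eigCoeff k : ℝ) * risingCoeff (k + twiceDim : ℝ) j *
      ∑ i ∈ Finset.range 5, (centreWeight i : ℝ) * (1 / (centre i : ℝ)) ^ (k + j) := by
  rw [imageCoeff, partialSum_eq]
  push_cast [cast_risingCoeff, cast_weightedPow]
  rfl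

lemma eigPoly_eq (u : ℝ) :
    eigPoly (2 / 7 + u) = ∑ j ∈ Finset.range 44, (eigTaylorCoeff j : ℝ) * u ^ j := by
  have h : ∀ k ∈ Finset.range 40, (2 / 7 + u) ^ k =
      ∑ j ∈ Finset.range 44, (k.choose j : ℝ) * (2 / 7) ^ (k - j) * u ^ j := fun k hk => by
    rw [add_comm, add_pow]
    have hk' := Finset.mem_range.1 hk
    rw [← Finset.sum_subset (Finset.range_subset_range.2 (by omega : k + 1 ≤ 44))]
    · exact Finset.sum_congr rfl fun j _ => by ring
    · intro j _ hj
      rw [Finset.mem_range, not_lt] at hj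
      rw [Nat.choose_eq_zero_of_lt (by omega)]
      simp
  rw [eigPoly, Finset.sum_congr rfl fun k hk => by rw [h k hk, Finset.mul_sum], Finset.sum_comm]
  refine Finset.sum_congr rfl fun j _ => ?_
  rw [eigTaylorCoeff, partialSum_eq]
  push_cast
  rw [Finset.sum_mul]
  exact Finset.sum_congr rfl fun k _ => by ring

lemma abs_sum_branchTerm_sub_le {u : ℝ} (hu : |u| ≤ 1 / 5) :
    |∑ i ∈ Finset.range 5, (centreWeight i : ℝ) * branchTerm u i -
      ∑ j ∈ Finset.range 44, (imageCoeff j : ℝ) * u ^ j| ≤ 2 / 10 ^ 40 := by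
  obtain ⟨hs1, hs2⟩ := cast_twiceDim_mem
  have hP : ∑ j ∈ Finset.range 44, (imageCoeff j : ℝ) * u ^ j =
      ∑ i ∈ Finset.range 5, (centreWeight i : ℝ) * ∑ k ∈ Finset.range 40, (eigCoeff k : ℝ) *
        (1 / (centre i : ℝ)) ^ k * ∑ j ∈ Finset.range 44,
          (-1) ^ j * risingCoeff (k + twiceDim : ℝ) j * (u / centre i) ^ j := by
    simp only [cast_imageCoeff, Finset.mul_sum, Finset.sum_mul]
    rw [Finset.sum_comm' (t' := Finset.range 40) (s' := fun _ => Finset.range 44) (by tauto)]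
    rw [Finset.sum_comm' (s := Finset.range 5) (t' := Finset.range 40)
      (s' := fun _ => Finset.range 5) (by tauto)]
    refine Finset.sum_congr rfl fun k _ => ?_
    rw [Finset.sum_comm]
    refine Finset.sum_congr rfl fun i _ => Finset.sum_congr rfl fun j _ => ?_
    rw [div_pow u, one_div_pow, one_div_pow, pow_add]
    ring
  have hT : (∑ k ∈ Finset.range 40, |(eigCoeff k : ℝ)| * risingCoeff (k + twiceDim : ℝ) 44 *
      ∑ i ∈ Finset.range 5, (centreWeight i : ℝ) * (1 / (centre i : ℝ)) ^ (k + 44)) ≤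
      5 ^ 44 * (1 / 10 ^ 40) := by
    have h := truncation_le
    rw [partialSum_eq] at h
    have h' := (Rat.cast_le (K := ℝ)).2 h
    push_cast [cast_risingCoeff, cast_weightedPow] at h'
    exact h'
  rw [hP, ← Finset.sum_sub_distrib]
  have hbound : ∀ i ∈ Finset.range 5, |(centreWeight i : ℝ) * branchTerm u i -
      (centreWeight i : ℝ) * ∑ k ∈ Finset.range 40, (eigCoeff k : ℝ) *
        (1 / (centre i : ℝ)) ^ k * ∑ j ∈ Finset.range 44,
          (-1) ^ j * risingCoeff (k + twiceDim : ℝ) j * (u / centre i) ^ j| ≤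
      ∑ k ∈ Finset.range 40, 2 / 5 ^ 44 * (|(eigCoeff k : ℝ)| * risingCoeff (k + twiceDim : ℝ) 44 *
        ((centreWeight i : ℝ) * (1 / (centre i : ℝ)) ^ (k + 44))) := fun i hi => by
    have hE := centreWeight_nonneg (Finset.mem_range.1 hi)
    have hX := centre_ge i
    have hX0 : (0 : ℝ) < centre i := by linarith
    rw [← mul_sub, branchTerm, ← Finset.sum_sub_distrib, Finset.mul_sum]
    refine (Finset.abs_sum_le_sum_abs _ _).trans (Finset.sum_le_sum fun k hk => ?_)
    have hk' : (k : ℝ) ≤ 39 := by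
      have := Finset.mem_range.1 hk
      exact_mod_cast (by omega : k ≤ 39)
    have hk0 : (0 : ℝ) ≤ k := Nat.cast_nonneg _
    have hv : |u / centre i| ≤ (1 / 5) * (1 / centre i) := by
      rw [abs_div, abs_of_pos hX0, div_eq_mul_one_div]
      exact mul_le_mul_of_nonneg_right hu (by positivity)
    have hv4 : |u / centre i| ≤ 1 / 4 := by
      refine hv.trans ?_
      have : 1 / (centre i : ℝ) ≤ 1 := by rw [div_le_one hX0]; linarith
      linarith
    have hrem := abs_one_add_rpow_sub_le (σ := k + twiceDim) (J := 44) (by linarith)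
      (by push_cast; linarith) hv4
    have hR := risingCoeff_nonneg (σ := (k + twiceDim : ℝ)) (by linarith) 44
    rw [← mul_sub, abs_mul, abs_mul, abs_mul, abs_of_nonneg hE,
      abs_of_nonneg (by positivity : 0 ≤ (1 / (centre i : ℝ)) ^ k)]
    calc (centreWeight i : ℝ) * (|(eigCoeff k : ℝ)| * (1 / (centre i : ℝ)) ^ k *
          |(1 + u / centre i) ^ (-(k + twiceDim : ℝ)) - ∑ j ∈ Finset.range 44,
            (-1) ^ j * risingCoeff (k + twiceDim : ℝ) j * (u / centre i) ^ j|)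
        ≤ (centreWeight i : ℝ) * (|(eigCoeff k : ℝ)| * (1 / (centre i : ℝ)) ^ k *
          (2 * risingCoeff (k + twiceDim : ℝ) 44 * ((1 / 5) * (1 / centre i)) ^ 44)) := by
          refine mul_le_mul_of_nonneg_left (mul_le_mul_of_nonneg_left (hrem.trans ?_)
            (by positivity)) hE
          exact mul_le_mul_of_nonneg_left (pow_le_pow_left₀ (abs_nonneg _) hv 44)
            (mul_nonneg zero_le_two hR)
      _ = _ := by rw [mul_pow, pow_add, one_div_pow 5]; ring
  refine (Finset.abs_sum_le_sum_abs _ _).trans ((Finset.sum_le_sum hbound).trans ?_)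
  rw [Finset.sum_comm]
  simp only [← Finset.mul_sum]
  calc _ ≤ 2 / 5 ^ 44 * (5 ^ 44 * (1 / 10 ^ 40) : ℝ) := by
        exact mul_le_mul_of_nonneg_left hT (by positivity)
    _ = 2 / 10 ^ 40 := by field_simp

/-- The 44 coefficient errors give `44 / 10^41` and the truncation `20 / 10^41`, together below `100
/ 10^41`. -/
lemma abs_sum_branchTerm_sub_eigPoly_le {u : ℝ} (hu : |u| ≤ 1 / 5) :
    |∑ i ∈ Finset.range 5, (centreWeight i : ℝ) * branchTerm u i - eigPoly (2 / 7 + u)| ≤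
      1 / 10 ^ 39 := by
  have h1 := abs_sum_branchTerm_sub_le hu
  have h2 : |∑ j ∈ Finset.range 44, (imageCoeff j : ℝ) * u ^ j - eigPoly (2 / 7 + u)| ≤
      44 / 10 ^ 41 := by
    rw [eigPoly_eq, ← Finset.sum_sub_distrib]
    have h3 : ∀ j ∈ Finset.range 44,
        |(imageCoeff j : ℝ) * u ^ j - (eigTaylorCoeff j : ℝ) * u ^ j| ≤ 1 / 10 ^ 41 := by
      intro j hj
      have h := (Rat.cast_le (K := ℝ)).2 (imageCoeff_sub_le j (Finset.mem_range.1 hj))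
      push_cast at h
      rw [← sub_mul, abs_mul, abs_pow]
      calc _ ≤ (5 ^ j * (1 / 10 ^ 41)) * (1 / 5 : ℝ) ^ j := by gcongr
        _ = 1 / 10 ^ 41 := by rw [one_div_pow]; field_simp
    refine (Finset.abs_sum_le_sum_abs _ _).trans ((Finset.sum_le_sum h3).trans ?_)
    rw [Finset.sum_const, Finset.card_range, nsmul_eq_mul]
    norm_num
  refine (abs_sub_le _ _ _).trans ((add_le_add h1 h2).trans ?_)
  norm_num

/-! ### Enclosures of the powers of the centres -/

lemma expTaylor_le_exp {y : ℚ} (hy : 0 ≤ y) : (expTaylor y : ℝ) ≤ Real.exp y := by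
  have := Real.sum_le_exp_of_nonneg (Rat.cast_nonneg.2 hy : (0 : ℝ) ≤ y) 36
  rw [expTaylor, partialSum_eq]
  push_cast
  exact this

lemma exp_le_expTaylor_add {y : ℚ} (hy : 0 ≤ y) (hy1 : y ≤ 1) :
    Real.exp y ≤ ((expTaylor y + expRemainder y : ℚ) : ℝ) := by
  have := Real.exp_bound' (Rat.cast_nonneg.2 hy : (0 : ℝ) ≤ y) (by exact_mod_cast hy1)
    (n := 36) (by norm_num)
  rw [expTaylor, expRemainder, partialSum_eq]
  push_cast at this ⊢
  exact this

lemma expTaylor_nonneg {y : ℚ} (hy : 0 ≤ y) : 0 ≤ expTaylor y := by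
  rw [expTaylor, partialSum_eq]; positivity

lemma centre_rpow_mem {i : ℕ} (hi : i < 5) :
    (centreWeight i : ℝ) ≤ (centre i : ℝ) ^ (-(twiceDim : ℝ)) ∧
      (centre i : ℝ) ^ (-(twiceDim : ℝ)) ≤ centreWeight i * (1 + 1 / 10 ^ 42) := by
  obtain ⟨⟨hE, hy, hy1, hz1⟩, h1, h2, h3, h4⟩ := centreWeight_check i hi
  have hX0 : (0 : ℝ) < centre i := by linarith [centre_ge i]
  have hs : (0 : ℚ) ≤ twiceDim := by
    have := cast_twiceDim_mem.1
    exact_mod_cast zero_le_one.trans this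
  set y := quarterLog i
  set y' := y + 1 / 10 ^ 46 with hy'
  have hy'0 : 0 ≤ y' := by positivity
  have hexp4 : ∀ x : ℝ, Real.exp x ^ 4 = Real.exp (4 * x) := fun x => by
    rw [← Real.exp_nat_mul]; norm_num
  have hlog1 : 4 * (y : ℝ) ≤ Real.log (centre i) := by
    rw [Real.le_log_iff_exp_le hX0, ← hexp4]
    calc Real.exp y ^ 4 ≤ ((expTaylor y + expRemainder y : ℚ) : ℝ) ^ 4 :=
          pow_le_pow_left₀ (Real.exp_pos _).le
            (exp_le_expTaylor_add hy (le_trans (by simp [hy']) hy1)) 4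
      _ ≤ _ := by exact_mod_cast h1
  have hlog2 : Real.log (centre i) ≤ 4 * (y' : ℝ) := by
    rw [Real.log_le_iff_le_exp hX0, ← hexp4]
    calc (centre i : ℝ) ≤ (expTaylor y' : ℝ) ^ 4 := by exact_mod_cast h2
      _ ≤ _ := pow_le_pow_left₀ (Rat.cast_nonneg.2 (expTaylor_nonneg hy'0))
          (expTaylor_le_exp hy'0) 4
  have hE' : (0 : ℝ) ≤ centreWeight i := by exact_mod_cast hE
  have hsR : (0 : ℝ) ≤ twiceDim := by exact_mod_cast hs
  rw [Real.rpow_neg hX0.le, Real.rpow_def_of_pos hX0]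
  have hpos := Real.exp_pos (Real.log (centre i) * twiceDim)
  rw [← one_div]
  constructor
  · rw [le_div_iff₀ hpos]
    calc (centreWeight i : ℝ) * Real.exp (Real.log (centre i) * twiceDim)
        ≤ centreWeight i * Real.exp ((twiceDim * y' : ℚ) : ℝ) ^ 4 := by
          refine mul_le_mul_of_nonneg_left ?_ hE'
          rw [hexp4, Real.exp_le_exp]
          push_cast
          nlinarith
      _ ≤ centreWeight i *
          ((expTaylor (twiceDim * y') + expRemainder (twiceDim * y') : ℚ) : ℝ) ^ 4 := by
          refine mul_le_mul_of_nonneg_left (pow_le_pow_left₀ (Real.exp_pos _).le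
            (exp_le_expTaylor_add (by positivity) hz1) 4) hE'
      _ ≤ 1 := by exact_mod_cast h3
  · rw [div_le_iff₀ hpos]
    calc (1 : ℝ) ≤ centreWeight i * (1 + 1 / 10 ^ 42) * (expTaylor (twiceDim * y) : ℝ) ^ 4 := by
          have h := (Rat.cast_le (K := ℝ)).2 h4
          push_cast at h
          exact h
      _ ≤ centreWeight i * (1 + 1 / 10 ^ 42) * Real.exp ((twiceDim * y : ℚ) : ℝ) ^ 4 := by
          have h0 : 0 ≤ twiceDim * y := by positivity
          exact mul_le_mul_of_nonneg_left (pow_le_pow_left₀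
            (Rat.cast_nonneg.2 (expTaylor_nonneg h0)) (expTaylor_le_exp h0) 4) (by positivity)
      _ ≤ _ := by
          refine mul_le_mul_of_nonneg_left ?_ (by positivity)
          rw [hexp4, Real.exp_le_exp]
          push_cast
          nlinarith

/-! ### Dimension bounds from test functions -/

section Dimension

variable {A : Finset ℕ} {t m M : ℝ} {f : ℝ → ℝ} {J : Set ℝ}

theorem le_dimH_of_le_cfTransfer (hA : ∀ a ∈ A, 2 ≤ a)
    (hgap : ∀ a ∈ A, ∀ b ∈ A, a < b → a + 2 ≤ b) (ht : 0 < t) (hJ : J ⊆ Icc 0 1)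
    (hJn : J.Nonempty) (hinv : ∀ a ∈ A, ∀ x ∈ J, cfBranch a x ∈ J) (hm : 0 < m)
    (hmM : ∀ x ∈ J, m ≤ f x ∧ f x ≤ M) (hf : ∀ x ∈ J, f x ≤ cfTransfer A t f x) :
    ENNReal.ofReal t ≤ dimH (cfLimitSet A) := by
  have hM : 0 < M := by
    obtain ⟨x, hx⟩ := hJn
    exact hm.trans_le ((hmM x hx).1.trans (hmM x hx).2)
  exact le_dimH_cfLimitSet hA hgap ht (div_pos hm hM)
    (le_scaleSum hA ht.le hJ hJn hinv hm hmM hf)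

theorem dimH_le_of_cfTransfer_le (hA : ∀ a ∈ A, 2 ≤ a) (ht : 0 ≤ t) (hJ : J ⊆ Icc 0 1)
    (hJn : J.Nonempty) (hinv : ∀ a ∈ A, ∀ x ∈ J, cfBranch a x ∈ J) (hm : 0 < m)
    (hmM : ∀ x ∈ J, m ≤ f x ∧ f x ≤ M) (hf : ∀ x ∈ J, cfTransfer A t f x ≤ f x) :
    dimH (cfLimitSet A) ≤ ENNReal.ofReal t :=
  dimH_cfLimitSet_le hA ht (scaleSum_le hA ht hJ hJn hinv hm hmM hf)

/-- Decreasing `t` increases the transfer operator. -/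
lemma one_add_mul_cfTransfer_le (hA : ∀ a ∈ A, 2 ≤ a) {η : ℝ} (hη : 0 ≤ η) (t : ℝ) {x : ℝ}
    (hx : 0 ≤ x) (hf : ∀ a ∈ A, 0 ≤ f (cfBranch a x)) :
    (1 + η) * cfTransfer A t f x ≤ cfTransfer A (t - η) f x := by
  rw [cfTransfer_eq hA _ _ hx, cfTransfer_eq hA _ _ hx, Finset.mul_sum]
  refine Finset.sum_le_sum fun a ha => ?_
  have ha2 : (2 : ℝ) ≤ a := by exact_mod_cast hA a ha
  have hpos : 0 < x + a := by linarith
  rw [show -(2 * (t - η)) = 2 * η + -(2 * t) by ring, Real.rpow_add hpos]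
  have h1 : 1 + η ≤ (x + a) ^ (2 * η) := by
    refine le_trans ?_ (Real.rpow_le_rpow zero_le_two (by linarith : (2 : ℝ) ≤ x + a)
      (by positivity))
    rw [Real.rpow_def_of_pos two_pos]
    have := Real.add_one_le_exp (Real.log 2 * (2 * η))
    nlinarith [Real.log_two_gt_d9]
  calc (1 + η) * (f (cfBranch a x) * (x + a) ^ (-(2 * t)))
      = f (cfBranch a x) * ((1 + η) * (x + a) ^ (-(2 * t))) := by ring
    _ ≤ _ := mul_le_mul_of_nonneg_left
        (mul_le_mul_of_nonneg_right h1 (Real.rpow_nonneg hpos.le _)) (hf a ha)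

/-- Increasing `t` slightly does not decrease the transfer operator by much. -/
lemma rpow_mul_cfTransfer_le (hA : ∀ a ∈ A, 2 ≤ a) {B : ℝ} (hB : ∀ a ∈ A, (a : ℝ) ≤ B) {η : ℝ}
    (hη : 0 ≤ η) (t : ℝ) {x : ℝ} (hx : x ∈ Icc (0 : ℝ) 1)
    (hf : ∀ a ∈ A, 0 ≤ f (cfBranch a x)) :
    (B + 1) ^ (-(2 * η)) * cfTransfer A t f x ≤ cfTransfer A (t + η) f x := by
  rw [cfTransfer_eq hA _ _ hx.1, cfTransfer_eq hA _ _ hx.1, Finset.mul_sum]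
  refine Finset.sum_le_sum fun a ha => ?_
  have ha2 : (2 : ℝ) ≤ a := by exact_mod_cast hA a ha
  have hpos : 0 < x + a := by linarith [hx.1]
  rw [show -(2 * (t + η)) = -(2 * η) + -(2 * t) by ring, Real.rpow_add hpos]
  have h1 : (B + 1) ^ (-(2 * η)) ≤ (x + a) ^ (-(2 * η)) :=
    Real.rpow_le_rpow_of_nonpos hpos (by linarith [hx.2, hB a ha]) (by linarith)
  calc (B + 1) ^ (-(2 * η)) * (f (cfBranch a x) * (x + a) ^ (-(2 * t)))
      = f (cfBranch a x) * ((B + 1) ^ (-(2 * η)) * (x + a) ^ (-(2 * t))) := by ring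
    _ ≤ _ := mul_le_mul_of_nonneg_left
        (mul_le_mul_of_nonneg_right h1 (Real.rpow_nonneg hpos.le _)) (hf a ha)

end Dimension

/-! ### The alphabet `{2, 4, 6, 8, 10}` -/

lemma two_le_of_mem_evenAlphabet : ∀ a ∈ evenAlphabet, 2 ≤ a := by decide

lemma gap_evenAlphabet : ∀ a ∈ evenAlphabet, ∀ b ∈ evenAlphabet, a < b → a + 2 ≤ b := by decide

lemma cast_le_ten_of_mem_evenAlphabet (a : ℕ) (ha : a ∈ evenAlphabet) : (a : ℝ) ≤ 10 := by
  have : ∀ a ∈ evenAlphabet, a ≤ 10 := by decide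
  exact_mod_cast this a ha

lemma cfBranch_mem_unit {A : Finset ℕ} (hA : ∀ a ∈ A, 2 ≤ a) :
    ∀ a ∈ A, ∀ x ∈ Icc (0 : ℝ) 1, cfBranch a x ∈ Icc (0 : ℝ) 1 := fun a ha _ hx =>
  wordMap_mem (l := [a]) (by simpa using hA a ha) hx

lemma cfBranch_mem_Icc_of_mem_evenAlphabet : ∀ a ∈ evenAlphabet,
    ∀ x ∈ Icc (3 / 35 : ℝ) (17 / 35), cfBranch a x ∈ Icc (3 / 35 : ℝ) (17 / 35) := by
  rintro a ha x ⟨h1, h2⟩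
  have ha2 : (2 : ℝ) ≤ a := by exact_mod_cast two_le_of_mem_evenAlphabet a ha
  have ha10 := cast_le_ten_of_mem_evenAlphabet a ha
  have hpos : 0 < x + a := by linarith
  constructor
  · rw [cfBranch, le_div_iff₀ hpos]; linarith
  · rw [cfBranch, div_le_iff₀ hpos]; linarith

/-- A test function bounds the dimension from below, strictly. -/
theorem lt_dimH_of_one_lt_iInf {t : ℝ} (ht : t ∈ Icc (0 : ℝ) 1) {f : ℝ → ℝ}
    (hf : IsPositiveHolder f)
    (h : 1 < ⨅ x : Icc (0 : ℝ) 1, cfTransfer evenAlphabet t f x / f x) :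
    ENNReal.ofReal t < dimH (cfLimitSet evenAlphabet) := by
  obtain ⟨⟨C, α, hα, -, hC⟩, hpos⟩ := hf
  set c := ⨅ x : Icc (0 : ℝ) 1, cfTransfer evenAlphabet t f x / f x with hc
  have hbdd : BddBelow (range fun x : Icc (0 : ℝ) 1 => cfTransfer evenAlphabet t f x / f x) := by
    -- A real infimum over a family unbounded below is 0 by convention, which `h` excludes.
    by_contra hcon
    rw [hc, Real.iInf_of_not_bddBelow hcon] at h
    linarith
  have hcf : ∀ x ∈ Icc (0 : ℝ) 1, c * f x ≤ cfTransfer evenAlphabet t f x := fun x hx => by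
    rw [← le_div_iff₀ (hpos x hx)]
    exact ciInf_le hbdd ⟨x, hx⟩
  have hcont : ContinuousOn f (Icc 0 1) := hC.continuousOn hα
  have hne : (Icc (0 : ℝ) 1).Nonempty := ⟨0, zero_mem_unit⟩
  obtain ⟨y, hy, hmin⟩ := isCompact_Icc.exists_isMinOn hne hcont
  obtain ⟨z, hz, hmax⟩ := isCompact_Icc.exists_isMaxOn hne hcont
  -- Chosen so that `11 ^ (-(2 * η)) = 1 / c`: raising `t` by `η` uses up exactly the margin `c`,
  -- since `x + a ≤ 11`.
  set η := Real.log c / (2 * Real.log 11) with hη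
  have hlogc : 0 < Real.log c := Real.log_pos h
  have hlog11 : 0 < Real.log 11 := Real.log_pos (by norm_num)
  have hη0 : 0 < η := by positivity
  have hc0 : 0 < c := by linarith
  have hpow : ((10 : ℝ) + 1) ^ (-(2 * η)) = c⁻¹ := by
    rw [show (10 : ℝ) + 1 = 11 by norm_num, Real.rpow_def_of_pos (by norm_num), ← Real.exp_log hc0,
      ← Real.exp_neg]
    congr 1
    rw [hη]; field_simp
  have hle : ENNReal.ofReal (t + η) ≤ dimH (cfLimitSet evenAlphabet) := by
    refine le_dimH_of_le_cfTransfer two_le_of_mem_evenAlphabet gap_evenAlphabet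
      (by linarith [ht.1]) Subset.rfl hne (cfBranch_mem_unit two_le_of_mem_evenAlphabet)
      (hpos y hy) (fun x hx => ⟨hmin hx, hmax hx⟩) fun x hx => ?_
    refine le_trans ?_ (rpow_mul_cfTransfer_le two_le_of_mem_evenAlphabet
      cast_le_ten_of_mem_evenAlphabet hη0.le t hx fun a ha =>
        (hpos _ (cfBranch_mem_unit two_le_of_mem_evenAlphabet a ha x hx)).le)
    rw [hpow, le_inv_mul_iff₀ hc0]
    exact hcf x hx
  refine lt_of_lt_of_le ?_ hle
  rw [ENNReal.ofReal_lt_ofReal_iff (by linarith [ht.1])]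
  linarith

/-! ### The value of the dimension -/

lemma eigPoly_mem {x : ℝ} (hx : x ∈ Icc (0 : ℝ) (1 / 2)) :
    1 / 2 ≤ eigPoly x ∧ eigPoly x ≤ 3 / 2 := by
  have h := (Rat.cast_le (K := ℝ)).2 sum_abs_eigCoeff_le
  rw [partialSum_eq] at h
  push_cast at h
  have hx0 := hx.1
  have hx2 := hx.2
  have hterm : ∀ k, |(eigCoeff k : ℝ) * x ^ k| ≤ |(eigCoeff k : ℝ)| * (1 / 2) ^ k := fun k => by
    rw [abs_mul, abs_of_nonneg (by positivity : 0 ≤ x ^ k)]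
    gcongr
  rw [eigPoly, Finset.sum_range_succ']
  rw [Finset.sum_range_succ'] at h
  have habs := (Finset.abs_sum_le_sum_abs (fun k => (eigCoeff (k + 1) : ℝ) * x ^ (k + 1))
    (Finset.range 39)).trans (Finset.sum_le_sum fun k _ => hterm (k + 1))
  simp only [eigCoeff_zero, Rat.cast_one, pow_zero, mul_one, abs_one] at h ⊢
  have := abs_le.1 habs
  constructor <;> linarith [this.1, this.2]

lemma eigPoly_branch_mul {u : ℝ} (hu : |u| ≤ 1 / 5) (i : ℕ) :
    eigPoly (1 / (centre i + u)) * (centre i + u : ℝ) ^ (-(twiceDim : ℝ)) =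
      (centre i : ℝ) ^ (-(twiceDim : ℝ)) * branchTerm u i := by
  have hX := centre_ge i
  have hX0 : (0 : ℝ) < centre i := by linarith
  have hv : |u / centre i| < 1 := by
    rw [abs_div, abs_of_pos hX0, div_lt_one hX0]; linarith
  have hv0 : 0 < 1 + u / centre i := by linarith [(abs_lt.1 hv).1]
  have he : (centre i + u : ℝ) = centre i * (1 + u / centre i) := by field_simp
  rw [he, Real.mul_rpow hX0.le hv0.le, eigPoly, branchTerm, Finset.sum_mul, Finset.mul_sum]
  refine Finset.sum_congr rfl fun k _ => ?_
  rw [neg_add, Real.rpow_add hv0, Real.rpow_neg hv0.le (k : ℝ), Real.rpow_natCast, one_div_pow,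
    one_div_pow, mul_pow]
  field_simp

lemma cfTransfer_eigPoly {u : ℝ} (hu : |u| ≤ 1 / 5) :
    cfTransfer evenAlphabet (twiceDim / 2) eigPoly (2 / 7 + u) =
      ∑ i ∈ Finset.range 5, (centre i : ℝ) ^ (-(twiceDim : ℝ)) * branchTerm u i := by
  have hu' := abs_le.1 hu
  rw [cfTransfer_eq two_le_of_mem_evenAlphabet _ _ (by linarith [hu'.1]),
    show -(2 * ((twiceDim : ℝ) / 2)) = -(twiceDim : ℝ) by ring]
  have hE : evenAlphabet = (Finset.range 5).image fun i => 2 * i + 2 := by decide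
  rw [hE, Finset.sum_image fun a _ b _ h => by simpa using h]
  refine Finset.sum_congr rfl fun i _ => ?_
  rw [← eigPoly_branch_mul hu, cfBranch]
  have he : 2 / 7 + u + ((2 * i + 2 : ℕ) : ℝ) = centre i + u := by
    rw [centre]; push_cast; ring
  rw [he]

/-- The absolute error `1 / 10^39` becomes relative through `eigPoly ≥ 1 / 2`; the rational weights
add a relative error `1 / 10^42`. -/
lemma cfTransfer_eigPoly_mem {x : ℝ} (hx : x ∈ Icc (3 / 35 : ℝ) (17 / 35)) :
    (1 - 2 / 10 ^ 39) * eigPoly x ≤ cfTransfer evenAlphabet (twiceDim / 2) eigPoly x ∧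
      cfTransfer evenAlphabet (twiceDim / 2) eigPoly x ≤ (1 + 4 / 10 ^ 39) * eigPoly x := by
  obtain ⟨u, rfl⟩ : ∃ u, x = 2 / 7 + u := ⟨x - 2 / 7, by ring⟩
  have hu : |u| ≤ 1 / 5 := abs_le.2 ⟨by linarith [hx.1], by linarith [hx.2]⟩
  have hf := eigPoly_mem (x := 2 / 7 + u) ⟨by linarith [hx.1], by linarith [hx.2]⟩
  have hΨ := abs_le.1 (abs_sum_branchTerm_sub_eigPoly_le hu)
  -- Nonnegativity allows the exact weights to be replaced by their rational bounds term by term.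
  have hB : ∀ i, 0 ≤ branchTerm u i := fun i => by
    have hX := centre_ge i
    have hpos : (2 : ℝ) ≤ centre i + u := by linarith [(abs_le.1 hu).1]
    have hXp : 0 < (centre i : ℝ) ^ (-(twiceDim : ℝ)) := Real.rpow_pos_of_pos (by linarith) _
    have h1 : 0 ≤ eigPoly (1 / (centre i + u)) := by
      have := (eigPoly_mem (x := 1 / (centre i + u)) ⟨by positivity,
        one_div_le_one_div_of_le two_pos hpos⟩).1
      linarith
    have h2 := mul_nonneg h1 (Real.rpow_nonneg (by linarith : (0 : ℝ) ≤ centre i + u)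
      (-(twiceDim : ℝ)))
    rw [eigPoly_branch_mul hu] at h2
    exact nonneg_of_mul_nonneg_right h2 hXp
  rw [cfTransfer_eigPoly hu]
  have hlow : ∑ i ∈ Finset.range 5, (centreWeight i : ℝ) * branchTerm u i ≤
      ∑ i ∈ Finset.range 5, (centre i : ℝ) ^ (-(twiceDim : ℝ)) * branchTerm u i :=
    Finset.sum_le_sum fun i hi =>
      mul_le_mul_of_nonneg_right (centre_rpow_mem (Finset.mem_range.1 hi)).1 (hB i)
  have hupp : ∑ i ∈ Finset.range 5, (centre i : ℝ) ^ (-(twiceDim : ℝ)) * branchTerm u i ≤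
      (1 + 1 / 10 ^ 42) * ∑ i ∈ Finset.range 5, (centreWeight i : ℝ) * branchTerm u i := by
    rw [Finset.mul_sum]
    refine Finset.sum_le_sum fun i hi => ?_
    rw [← mul_assoc, mul_comm (1 + _)]
    exact mul_le_mul_of_nonneg_right (centre_rpow_mem (Finset.mem_range.1 hi)).2 (hB i)
  obtain ⟨hf1, hf2⟩ := hf
  obtain ⟨hΨ1, hΨ2⟩ := hΨ
  constructor <;> linarith

/-- The margins are unequal because `twiceDim / 2` lies about `0.905 / 10^37` above the 37-digit
truncation, leaving less than `10^(-38)` of room above it. -/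
theorem dimH_evenAlphabet_mem :
    ENNReal.ofReal (twiceDim / 2 - 4 / 10 ^ 38) ≤ dimH (cfLimitSet evenAlphabet) ∧
      dimH (cfLimitSet evenAlphabet) ≤ ENNReal.ofReal (twiceDim / 2 + 9 / 10 ^ 39) := by
  obtain ⟨hs1, hs2⟩ := cast_twiceDim_mem
  have hJ : Icc (3 / 35 : ℝ) (17 / 35) ⊆ Icc 0 1 := Icc_subset_Icc (by norm_num) (by norm_num)
  have hJn : (Icc (3 / 35 : ℝ) (17 / 35)).Nonempty := nonempty_Icc.2 (by norm_num)
  have hf : ∀ x ∈ Icc (3 / 35 : ℝ) (17 / 35), 1 / 2 ≤ eigPoly x ∧ eigPoly x ≤ 3 / 2 :=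
    fun x hx => eigPoly_mem ⟨by linarith [hx.1], by linarith [hx.2]⟩
  have hf0 : ∀ x ∈ Icc (3 / 35 : ℝ) (17 / 35), ∀ a ∈ evenAlphabet, 0 ≤ eigPoly (cfBranch a x) :=
    fun x hx a ha => by linarith [(hf _ (cfBranch_mem_Icc_of_mem_evenAlphabet a ha x hx)).1]
  constructor
  · refine le_dimH_of_le_cfTransfer two_le_of_mem_evenAlphabet gap_evenAlphabet (by linarith) hJ hJn
      cfBranch_mem_Icc_of_mem_evenAlphabet (by norm_num : (0 : ℝ) < 1 / 2) hf fun x hx => ?_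
    have h := one_add_mul_cfTransfer_le two_le_of_mem_evenAlphabet
      (by norm_num : (0 : ℝ) ≤ 4 / 10 ^ 38) (twiceDim / 2) (by linarith [hx.1]) (hf0 x hx)
    have h1 := (cfTransfer_eigPoly_mem hx).1
    have h2 := (hf x hx).1
    linarith
  · refine dimH_le_of_cfTransfer_le two_le_of_mem_evenAlphabet (by linarith) hJ hJn
      cfBranch_mem_Icc_of_mem_evenAlphabet (by norm_num : (0 : ℝ) < 1 / 2) hf fun x hx => ?_
    have h := one_add_mul_cfTransfer_le two_le_of_mem_evenAlphabet
      (by norm_num : (0 : ℝ) ≤ 9 / 10 ^ 39) (twiceDim / 2 + 9 / 10 ^ 39) (by linarith [hx.1])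
      (hf0 x hx)
    rw [add_sub_cancel_right] at h
    have h1 := (cfTransfer_eigPoly_mem hx).2
    have h2 := (hf x hx).1
    linarith

theorem lt_dimH_evenAlphabet : ENNReal.ofReal 0.5173570309370173046666284748364397337 <
    dimH (cfLimitSet evenAlphabet) := by
  refine lt_of_lt_of_le ?_ dimH_evenAlphabet_mem.1
  rw [ENNReal.ofReal_lt_ofReal_iff_of_nonneg (by norm_num), twiceDim]
  norm_num

theorem dimH_evenAlphabet_lt : dimH (cfLimitSet evenAlphabet) <
    ENNReal.ofReal (0.5173570309370173046666284748364397337 + 10 ^ (-37 : ℤ)) := by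
  refine lt_of_le_of_lt dimH_evenAlphabet_mem.2 ?_
  rw [ENNReal.ofReal_lt_ofReal_iff (by norm_num), twiceDim]
  norm_num

theorem one_half_lt_dimH_evenAlphabet : (1 / 2 : ℝ≥0∞) < dimH (cfLimitSet evenAlphabet) := by
  refine lt_trans ?_ lt_dimH_evenAlphabet
  rw [show (1 / 2 : ℝ≥0∞) = ENNReal.ofReal (1 / 2) by
    rw [ENNReal.ofReal_div_of_pos two_pos]; simp]
  rw [ENNReal.ofReal_lt_ofReal_iff (by norm_num)]
  norm_num

/-! ### The test function `8 - 2 x` -/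

lemma isPositiveHolder_eight_sub : IsPositiveHolder fun x => 8 - 2 * x := by
  refine ⟨⟨2, 1, one_pos, le_rfl, ?_⟩, fun x hx => by linarith [hx.2]⟩
  rw [holderOnWith_one]
  refine LipschitzOnWith.of_dist_le_mul fun x _ y _ => ?_
  rw [Real.dist_eq, Real.dist_eq, show 8 - 2 * x - (8 - 2 * y) = -(2 * (x - y)) by ring, abs_neg,
    abs_mul]
  norm_num

/-- The tangent of the convex function `y ↦ 8 / y - 2 / y ^ 2`. -/
lemma tangent_le {y c : ℝ} (hy : 2 ≤ y) (hc : 2 ≤ c) :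
    8 / c - 2 / c ^ 2 + (-8 / c ^ 2 + 4 / c ^ 3) * (y - c) ≤ (8 - 2 * (1 / y)) * y⁻¹ := by
  have hy0 : 0 < y := by linarith
  have hc0 : 0 < c := by linarith
  have he : (8 - 2 * (1 / y)) * y⁻¹ -
      (8 / c - 2 / c ^ 2 + (-8 / c ^ 2 + 4 / c ^ 3) * (y - c)) =
      (y - c) ^ 2 * (8 * (y * c) - 2 * c - 4 * y) / (y ^ 2 * c ^ 3) := by
    field_simp
    ring
  have h1 : 0 ≤ 8 * (y * c) - 2 * c - 4 * y := by nlinarith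
  have h2 : 0 ≤ (y - c) ^ 2 * (8 * (y * c) - 2 * c - 4 * y) / (y ^ 2 * c ^ 3) := by positivity
  linarith

lemma one_lt_iInf_eight_sub : 1 < ⨅ x : Icc (0 : ℝ) 1,
    cfTransfer evenAlphabet (1 / 2) (fun y => 8 - 2 * y) x / (8 - 2 * (x : ℝ)) := by
  have : Nonempty (Icc (0 : ℝ) 1) := ⟨⟨0, zero_mem_unit⟩⟩
  refine lt_of_lt_of_le (by norm_num : (1 : ℝ) < 1.01) (le_ciInf fun ⟨x, hx⟩ => ?_)
  have hx0 := hx.1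
  have hx1 := hx.2
  rw [le_div_iff₀ (by linarith), cfTransfer_eq two_le_of_mem_evenAlphabet _ _ hx0]
  -- Tangents are taken at the midpoint `x = 1 / 2`. They leave an inequality affine in `x`.
  have h2 := tangent_le (y := x + 2) (c := 5 / 2) (by linarith) (by norm_num)
  have h4 := tangent_le (y := x + 4) (c := 9 / 2) (by linarith) (by norm_num)
  have h6 := tangent_le (y := x + 6) (c := 13 / 2) (by linarith) (by norm_num)
  have h8 := tangent_le (y := x + 8) (c := 17 / 2) (by linarith) (by norm_num)
  have h10 := tangent_le (y := x + 10) (c := 21 / 2) (by linarith) (by norm_num)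
  have hp : ∀ y : ℝ, y ^ (-(2 * (1 / 2 : ℝ))) = y⁻¹ := fun y => by
    rw [show -(2 * (1 / 2 : ℝ)) = -1 by norm_num, Real.rpow_neg_one]
  simp only [hp, cfBranch, evenAlphabet]
  rw [Finset.sum_insert (by decide), Finset.sum_insert (by decide), Finset.sum_insert (by decide),
    Finset.sum_insert (by decide), Finset.sum_singleton]
  push_cast
  norm_num at h2 h4 h6 h8 h10 ⊢
  linarith

/-! ### The obstruction modulo four -/

lemma exists_fraction_mod_four {l : List ℕ} (hl : ∀ a ∈ l, 2 ≤ a ∧ a % 2 = 0) :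
    ∃ p q : ℕ, 0 < q ∧ Nat.Coprime p q ∧ cfValue l = (p : ℝ) / q ∧
      (p % 4 = 0 ∧ q % 4 = 1 ∨ p % 4 = 2 ∧ q % 4 = 1 ∨ p % 4 = 1 ∧ q % 4 = 0 ∨
        p % 4 = 1 ∧ q % 4 = 2) := by
  induction l with
  | nil => exact ⟨0, 1, one_pos, by decide, by simp [cfValue], by decide⟩
  | cons a l ih =>
    obtain ⟨p, q, hq, hpq, hv, hmod⟩ := ih fun b hb => hl b (List.mem_cons_of_mem _ hb)
    obtain ⟨ha, ha2⟩ := hl a (by simp)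
    obtain ⟨b, rfl⟩ : ∃ b, a = 2 * b := ⟨a / 2, by omega⟩
    refine ⟨q, p + 2 * b * q, ?_, ?_, ?_, ?_⟩
    · have : 0 < 2 * b * q := Nat.mul_pos (by omega) hq
      omega
    · rw [Nat.coprime_add_mul_right_right]; exact hpq.symm
    · have hq' : (0 : ℝ) < q := by exact_mod_cast hq
      change 1 / (cfValue l + ((2 * b : ℕ) : ℝ)) = _
      rw [hv]
      push_cast
      field_simp
    · have h : (p + 2 * b * q) % 4 = (p % 4 + 2 * (b % 2) * (q % 4)) % 4 := by
        obtain ⟨r, s, hr, rfl⟩ : ∃ r s, s < 2 ∧ b = 2 * r + s := ⟨b / 2, b % 2, by omega, by omega⟩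
        have hs : (2 * r + s) % 2 = s := by omega
        rw [hs, show p + 2 * (2 * r + s) * q = p + 2 * s * q + 4 * (r * q) by ring,
          Nat.add_mul_mod_self_left]
        exact (Nat.mod_modEq p 4).symm.add ((Nat.mod_modEq q 4).symm.mul_left _)
      rw [h]
      rcases Nat.mod_two_eq_zero_or_one b with hb | hb <;>
        rcases hmod with ⟨h1, h2⟩ | ⟨h1, h2⟩ | ⟨h1, h2⟩ | ⟨h1, h2⟩ <;> simp [hb, h1, h2]

theorem not_modEq_three_of_hasDigitsIn {p q : ℕ} (hpq : Nat.Coprime p q)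
    (h : HasDigitsIn evenAlphabet p q) : ¬ q ≡ 3 [MOD 4] := by
  obtain ⟨l, -, hl, hv⟩ := h
  have heven : ∀ a ∈ evenAlphabet, 2 ≤ a ∧ a % 2 = 0 := by decide
  obtain ⟨r, s, hs, hrs, hv', hmod⟩ := exists_fraction_mod_four fun a ha => heven a (hl a ha)
  intro hq
  have hq4 : q % 4 = 3 := hq
  have hq0 : 0 < q := by omega
  rw [hv', div_eq_div_iff (by positivity) (by positivity)] at hv
  have hv2 : p * s = r * q := by exact_mod_cast hv
  have h1 : q ∣ s := hpq.symm.dvd_of_dvd_mul_left ⟨r, by rw [hv2, mul_comm]⟩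
  have h2 : s ∣ q := hrs.symm.dvd_of_dvd_mul_left ⟨p, by rw [← hv2, mul_comm]⟩
  have h3 := Nat.dvd_antisymm h1 h2
  omega

lemma cfValue_pos {l : List ℕ} (hl : ∀ a ∈ l, 2 ≤ a) (hne : l ≠ []) : 0 < cfValue l := by
  cases l with
  | nil => exact (hne rfl).elim
  | cons a l =>
    have h0 := (wordMap_mem (fun b hb => hl b (List.mem_cons_of_mem _ hb)) zero_mem_unit).1
    have ha : (2 : ℝ) ≤ a := by exact_mod_cast hl a (by simp)
    rw [cfValue_eq_wordMap, wordMap_cons]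
    exact one_div_pos.2 (by linarith)

theorem not_hensleyProperty_evenAlphabet : ¬ HensleyProperty evenAlphabet := by
  rintro ⟨q₀, -, h⟩
  -- A prime `q` is taken since the property does not ask for `p / q` in lowest terms; `0 < p < q`
  -- then forces coprimality.
  obtain ⟨q, hq, hprime, hmod⟩ :=
    Nat.forall_exists_prime_gt_and_modEq q₀ (q := 4) (a := 3) (by norm_num) (by decide)
  obtain ⟨p, hpq, hd⟩ := h q hq.le
  have hp : 0 < p := by
    obtain ⟨l, hne, hl, hv⟩ := hd
    have := cfValue_pos (fun a ha => two_le_of_mem_evenAlphabet a (hl a ha)) hne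
    rw [← hv] at this
    refine Nat.pos_of_ne_zero fun h0 => ?_
    simp [h0] at this
  exact not_modEq_three_of_hasDigitsIn (Nat.coprime_of_lt_prime hp.ne' hpq hprime).symm hd hmod

theorem not_hensleyConjecture : ¬ HensleyConjecture := fun h =>
  not_hensleyProperty_evenAlphabet
    (h evenAlphabet (fun a ha => one_le_two.trans (two_le_of_mem_evenAlphabet a ha))
      one_half_lt_dimH_evenAlphabet)

theorem mainTheorem11 :
    -- the dimension to 37 digits
    (ENNReal.ofReal 0.5173570309370173046666284748364397337 < dimH (cfLimitSet evenAlphabet) ∧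
      dimH (cfLimitSet evenAlphabet) <
        ENNReal.ofReal (0.5173570309370173046666284748364397337 + 10 ^ (-37 : ℤ))) ∧
    -- in particular it exceeds one half
    (1 / 2 : ℝ≥0∞) < dimH (cfLimitSet evenAlphabet) ∧
    -- test functions bound the dimension from below
    (∀ t ∈ Icc (0 : ℝ) 1, ∀ f : ℝ → ℝ, IsPositiveHolder f →
      1 < ⨅ x : Icc (0 : ℝ) 1, cfTransfer evenAlphabet t f x / f x →
      ENNReal.ofReal t < dimH (cfLimitSet evenAlphabet)) ∧
    -- and `8 - 2 x` is such a test function for the bound one half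
    (IsPositiveHolder (fun x => 8 - 2 * x) ∧
      1 < ⨅ x : Icc (0 : ℝ) 1,
        cfTransfer evenAlphabet (1 / 2) (fun y => 8 - 2 * y) x / (8 - 2 * (x : ℝ))) ∧
    -- the obstruction modulo 4
    (∀ p q : ℕ, Nat.Coprime p q → HasDigitsIn evenAlphabet p q → ¬ q ≡ 3 [MOD 4]) ∧
    -- the counterexample to the conjecture
    ¬ HensleyProperty evenAlphabet ∧ ¬ HensleyConjecture := by
  exact ⟨⟨lt_dimH_evenAlphabet, dimH_evenAlphabet_lt⟩, one_half_lt_dimH_evenAlphabet,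
    fun _ ht _ hf h => lt_dimH_of_one_lt_iInf ht hf h,
    ⟨isPositiveHolder_eight_sub, one_lt_iInf_eight_sub⟩,
    fun _ _ hpq h => not_modEq_three_of_hasDigitsIn hpq h,
    not_hensleyProperty_evenAlphabet, not_hensleyConjecture⟩
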